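/- Let $(W_i)_{i\in\omega}$ be the standard enumeration of the computably enumerable (c.e.) subsets of $\omega$ ($W_i$ is the domain of the $i$-th partial computable function), and let $(E_i)_{i\in\omega}$ be the natural enumeration of the ceers (c.e. equivalence relations on $\omega$): $E_i$ is the equivalence relation generated by $\{(x,y) : \langle x,y\rangle\in W_i\}$. For equivalence relations $E,R$ on $\omega$, write $E\equiv R$ if there are computable functions $f,g:\omega\to\omega$ such that, for all $x,y$, $x\,E\,y\Leftrightarrow f(x)\,R\,f(y)$ and $x\,R\,y\Leftrightarrow g(x)\,E\,g(y)$. For $S\subseteq\omega$ let $[S]=\{i : \exists j\in S\ (E_i\equiv E_j)\}$. Call $S$ proper on the infinite ceers if there are $i\in[S]$ and $j\notin[S]$ such that $E_i$ and $E_j$ both have infinitely many classes. Let $0'''$ be the third Turing jump of the empty set. Let $\le_m$ and $\le_1$ denote many-one and one-one reducibility, and write $A<_m B$ if $A\le_m B$ and $B\not\le_m A$; similarly for $<_1$. Corollary. Let $S\subseteq\omega$ be such that $[S]$ is proper on the infinite ceers. Then neither $[S]<_m 0'''$ nor $[S]<_1 0'''$ holds. Moreover, if $[S]\le_m 0'''$,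 then $0'''\le_1 [S]$. -/

import Mathlib

/-- The `i`-th computably enumerable set `W_i`: the domain of the `i`-th partial computable
function. -/
def ceSet (i : ℕ) : Set ℕ :=
  {n | (Nat.Partrec.Code.eval (Denumerable.ofNat Nat.Partrec.Code i) n).Dom}

/-- The `i`-th ceer `E_i` (computably enumerable equivalence relation on `ℕ`): the equivalence
relation generated by the set of pairs `(x, y)` with `⟨x, y⟩ ∈ W_i`. -/
def ceer (i : ℕ) : Setoid ℕ :=
  Relation.EqvGen.setoid (fun x y => Nat.pair x y ∈ ceSet i)

/-- Computable reducibility of equivalence relations on `ℕ`. -/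
def CompReducible (E R : Setoid ℕ) : Prop :=
  ∃ f : ℕ → ℕ, Computable f ∧ ∀ x y, E x y ↔ R (f x) (f y)

/-- Computable equivalence `E ≡ R` of equivalence relations on `ℕ`. -/
def CompEquiv (E R : Setoid ℕ) : Prop :=
  CompReducible E R ∧ CompReducible R E

/-- `[S]`, the closure of a set of indices of ceers under computable equivalence. -/
def ceerClosure (S : Set ℕ) : Set ℕ :=
  {i | ∃ j ∈ S, CompEquiv (ceer i) (ceer j)}

/-- `S` is proper on the infinite ceers: `[S]` contains some, but not every, index of a ceer with
infinitely many classes. -/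
def ProperOnInfiniteCeers (S : Set ℕ) : Prop :=
  ∃ i j : ℕ, Infinite (Quotient (ceer i)) ∧ Infinite (Quotient (ceer j)) ∧
    i ∈ ceerClosure S ∧ j ∉ ceerClosure S

/-- The finite binary string `σ` is an initial segment of the characteristic function of `X`. -/
def IsInitialSegment (σ : List Bool) (X : Set ℕ) : Prop :=
  ∀ k : ℕ, ∀ h : k < σ.length, σ[k] = true ↔ k ∈ X

/-- `W_e^X`, the `e`-th set that is computably enumerable relative to the oracle `X`: `n` is
enumerated if the `e`-th program halts on `n` together with some finite amount of information about
the oracle (the use of the computation). -/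
def ceSetRel (e : ℕ) (X : Set ℕ) : Set ℕ :=
  {n | ∃ σ : List Bool, IsInitialSegment σ X ∧ Nat.pair n (Encodable.encode σ) ∈ ceSet e}

/-- The Turing jump `X' = {e | e ∈ W_e^X}`. -/
def turingJump (X : Set ℕ) : Set ℕ :=
  {e | e ∈ ceSetRel e X}

/-- `0'''`, the third Turing jump of the empty set. -/
def zeroTripleJump : Set ℕ :=
  turingJump (turingJump (turingJump ∅))

/-- Many-one reducibility `A ≤_m B` of sets of natural numbers. -/
def SetMReducible (A B : Set ℕ) : Prop :=
  ManyOneReducible (fun n => n ∈ A) (fun n => n ∈ B)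

/-- One-one reducibility `A ≤_1 B` of sets of natural numbers. -/
def SetOneReducible (A B : Set ℕ) : Prop :=
  OneOneReducible (fun n => n ∈ A) (fun n => n ∈ B)

/-- `A <_m B`. -/
def SetMLt (A B : Set ℕ) : Prop :=
  SetMReducible A B ∧ ¬ SetMReducible B A

/-- `A <_1 B`. -/
def SetOneLt (A B : Set ℕ) : Prop :=
  SetOneReducible A B ∧ ¬ SetOneReducible B A

/-!
Only one implication needs work: if `[S]` is many-one reducible to `0'''`, then `0'''` is one-one
reducible to `[S]`. The two non-reducibility claims follow at once.

Fix ceers `X` with index in `[S]` and `Y` with index outside `[S]`, both with infinitely many classes.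
The set `0'''` is `Σ₃`: `n ∈ 0'''` holds if and only if one of the uniformly computable sets
`P n 0, P n 1, …` is infinite (`exists_primrec_zeroTripleJump`). By the assumption on `[S]` and the
recursion theorem (`exists_fixedPoint_index`), a ceer `R` with index `f n` can be built while knowing
a number `m` such that `f n ∈ [S]` if and only if `m ∈ 0'''`. The sets `P n w` and `P m w` are put
in competition: strategy `2 * w` watches `P n w` and wants `R ≡ X`, strategy `2 * w + 1` watches
`P m w` and wants `R ≡ Y`, and a strategy acts each time its set gets a new element. The core of the
proof is that `R` can be built so that the least strategy that acts infinitely often, if there is one,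
gets its wish (`compEquiv_dynSetoid`). Granting this, suppose that some strategy acts infinitely
often, and consider the least such one.
If it is odd, then `m ∈ 0'''`, so `f n ∈ [S]`, while `R ≡ Y` gives `f n ∉ [S]`; this is impossible.
So it is even, which gives both `n ∈ 0'''` and, as `R ≡ X`, `f n ∈ [S]`. If no strategy acts
infinitely often, then `n ∉ 0'''` and `f n ∉ [S]`. In all cases `n ∈ 0''' ↔ f n ∈ [S]`.

In the construction of `R` the numbers that are in use form a stack of pairwise inequivalent numbers.
When strategy `k` acts at stage `s`, the numbers of weaker strategies are merged with the new number
`s`, and the numbers of stronger strategies are left alone. If there are `p` of the latter, they are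
matched with the `p` least representatives of classes of the current approximation of the target of
`k`, and the own numbers of `k` with the representatives that follow; own numbers whose label has
lost its place among these are merged with the number matched to the present representative of the
label. If `k` is the least strategy that acts infinitely often, then the `p` numbers of stronger
strategies are eventually fixed. Since the target has infinitely many classes, its `p` least
representatives are eventually fixed as well (`IsApprox.exists_stable`), and from then on the matching
respects both equivalence relations. It is a computably enumerable matching between all numbers on
either side, and so gives reductions in both directions (`compReducible_of_matching`).
-/

open Encodable Denumerable

/-! ### Primitive recursive predicates with parameters -/

section Primrec
variable {α β : Type*} [Primcodable α] [Primcodable β]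

theorem Primrec.filter_param {f : α → List β} {p : α → β → Prop} [DecidableRel p]
    (hf : Primrec f) (hp : PrimrecRel p) : Primrec fun a => (f a).filter (fun b => p a b) := by
  have h : Primrec fun a => (f a).filterMap (fun b => if p a b then some b else none) :=
    Primrec.listFilterMap hf (Primrec.ite hp (Primrec.option_some.comp Primrec.snd)
      (Primrec.const none))
  refine h.of_eq fun a => ?_
  rw [← List.filterMap_eq_filter]
  congr 1
  funext b
  simp [Option.guard]

theorem PrimrecPred.exists_lt_param {f : α → ℕ} {p : α → ℕ → Prop} (hf : Primrec f)
    (hp : PrimrecRel p) : PrimrecPred fun a => ∃ x < f a, p a x :=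
  ((PrimrecRel.exists_mem_list (R := fun x a => p a x) hp.swap).comp
    (Primrec.list_range.comp hf) Primrec.id).of_eq fun a => by simp

theorem PrimrecPred.forall_lt_param {f : α → ℕ} {p : α → ℕ → Prop} (hf : Primrec f)
    (hp : PrimrecRel p) : PrimrecPred fun a => ∀ x < f a, p a x :=
  ((PrimrecRel.forall_mem_list (R := fun x a => p a x) hp.swap).comp
    (Primrec.list_range.comp hf) Primrec.id).of_eq fun a => by simp

theorem PrimrecPred.imp {p q : α → Prop} (hp : PrimrecPred p) (hq : PrimrecPred q) :
    PrimrecPred fun a => p a → q a :=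
  (hp.not.or hq).of_eq fun a => by tauto

end Primrec

/-! ### Arithmetical complexity of the iterated jump -/

/-- The `e`-th program has halted on input `n` within `u` steps. -/
def HaltsWithin (u e n : ℕ) : Prop :=
  (Nat.Partrec.Code.evaln u (ofNat Nat.Partrec.Code e) n).isSome

theorem mem_ceSet_iff {e n : ℕ} : n ∈ ceSet e ↔ ∃ u, HaltsWithin u e n := by
  simp only [ceSet, Set.mem_ofPred_eq, HaltsWithin, Part.dom_iff_mem, Option.isSome_iff_exists]
  constructor
  · rintro ⟨y, hy⟩
    obtain ⟨u, hu⟩ := Nat.Partrec.Code.evaln_complete.1 hy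
    exact ⟨u, y, hu⟩
  · rintro ⟨u, y, hu⟩
    exact ⟨y, Nat.Partrec.Code.evaln_complete.2 ⟨u, hu⟩⟩

theorem primrecPred_haltsWithin {α : Type*} [Primcodable α] {u e n : α → ℕ}
    (hu : Primrec u) (he : Primrec e) (hn : Primrec n) :
    PrimrecPred fun a => HaltsWithin (u a) (e a) (n a) := by
  classical
  have h : Primrec fun a => (Nat.Partrec.Code.evaln (u a)
      (ofNat Nat.Partrec.Code (e a)) (n a)).isSome :=
    Primrec.option_isSome.comp (Nat.Partrec.Code.primrec_evaln.comp
      ((hu.pair ((Primrec.ofNat _).comp he)).pair hn))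
  exact (Primrec.eq.comp h (Primrec.const true)).of_eq fun a => Iff.rfl

/-- The computation `e ∈ W_e^X` along the initial segment coded by `σ` halts within `u` steps. -/
def JumpHalts (e : ℕ) (σ : List Bool) (u : ℕ) : Prop :=
  HaltsWithin u e (Nat.pair e (encode σ))

theorem mem_turingJump_iff {X : Set ℕ} {e : ℕ} :
    e ∈ turingJump X ↔ ∃ σ u, IsInitialSegment σ X ∧ JumpHalts e σ u := by
  simp only [turingJump, ceSetRel, Set.mem_ofPred_eq, mem_ceSet_iff, JumpHalts]
  simp only [← exists_and_left]

theorem isInitialSegment_iff {σ : List Bool} {X : Set ℕ} :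
    IsInitialSegment σ X ↔
      ∀ k < σ.length, (σ[k]? = some true → k ∈ X) ∧ (σ[k]? = some false → k ∉ X) := by
  refine forall_congr' fun k => forall_congr' fun h => ?_
  rw [List.getElem?_eq_getElem h]
  cases σ[k] <;> simp

/-- A statement `∀ m ∃ j` is turned into the infinity of a set, which contains `⟨m, b⟩` when `b` is
the least common bound for witnesses for all `i ≤ m`. -/
theorem infinite_setOf_least_bound (Q : ℕ → ℕ → Prop) :
    {t : ℕ | (∀ i < t.unpair.1 + 1, ∃ j < t.unpair.2, Q i j) ∧
      ¬ ∀ i < t.unpair.1 + 1, ∃ j < t.unpair.2 - 1, Q i j}.Infinite ↔ ∀ m, ∃ j, Q m j := by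
  classical
  constructor
  · intro h m
    by_contra hm
    push Not at hm
    apply h
    have key : ∀ n b b' : ℕ, ((∀ i < n + 1, ∃ j < b, Q i j) ∧ ¬ ∀ i < n + 1, ∃ j < b - 1, Q i j) →
        ((∀ i < n + 1, ∃ j < b', Q i j) ∧ ¬ ∀ i < n + 1, ∃ j < b' - 1, Q i j) → b ≤ b' := by
      intro n b b' h1 h2
      by_contra hlt
      refine h1.2 fun i hi => ?_
      obtain ⟨j, hj, hq⟩ := h2.1 i hi
      exact ⟨j, by omega, hq⟩
    refine Set.Finite.of_finite_image (f := fun t : ℕ => t.unpair.1)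
      ((Set.finite_lt_nat m).subset ?_) ?_
    · rintro _ ⟨t, ht, rfl⟩
      show t.unpair.1 < m
      by_contra hlt
      obtain ⟨j, -, hj⟩ := ht.1 m (by omega)
      exact hm j hj
    · intro t ht t' ht' heq
      have heq' : t.unpair.1 = t'.unpair.1 := heq
      simp only [Set.mem_ofPred_eq] at ht ht'
      rw [← heq'] at ht'
      have h2 : t.unpair.2 = t'.unpair.2 := le_antisymm (key _ _ _ ht ht') (key _ _ _ ht' ht)
      rw [← Nat.pair_unpair t, ← Nat.pair_unpair t', heq', h2]
  · intro h
    have hb : ∀ m, ∃ b, ∀ i < m + 1, ∃ j < b, Q i j := by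
      intro m
      choose g hg using h
      refine ⟨(Finset.range (m + 1)).sup g + 1, fun i hi => ⟨g i, ?_, hg i⟩⟩
      exact Nat.lt_succ_of_le (Finset.le_sup (Finset.mem_range.2 hi))
    refine Set.infinite_of_injective_forall_mem (f := fun m => Nat.pair m (Nat.find (hb m))) ?_ ?_
    · intro m m' hmm
      exact (Nat.pair_eq_pair.1 hmm).1
    · intro m
      simp only [Set.mem_ofPred_eq, Nat.unpair_pair]
      refine ⟨Nat.find_spec (hb m), ?_⟩
      obtain ⟨j, hj, -⟩ := Nat.find_spec (hb m) 0 (by omega)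
      exact Nat.find_min (hb m) (by omega)

theorem mem_jump_empty_iff {e : ℕ} :
    e ∈ turingJump ∅ ↔ ∃ w : ℕ, JumpHalts e (List.replicate w.unpair.1 false) w.unpair.2 := by
  rw [mem_turingJump_iff]
  constructor
  · rintro ⟨σ, u, hσ, hu⟩
    refine ⟨Nat.pair σ.length u, ?_⟩
    have : σ = List.replicate σ.length false := by
      refine List.eq_replicate_iff.2 ⟨rfl, fun b hb => ?_⟩
      obtain ⟨k, hk, rfl⟩ := List.getElem_of_mem hb
      have := hσ k hk
      simpa using this
    simp only [Nat.unpair_pair]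
    rwa [← this]
  · rintro ⟨w, hw⟩
    refine ⟨_, _, ?_, hw⟩
    intro k hk
    simp

theorem primrec_replicate_false : Primrec fun n : ℕ => List.replicate n false :=
  (Primrec.list_map Primrec.list_range (Primrec.const false).to₂).of_eq fun n => by
    simp

theorem exists_primrecRel_jump_one :
    ∃ P : ℕ → ℕ → Prop, PrimrecRel P ∧ ∀ n, n ∈ turingJump ∅ ↔ ∃ w, P n w := by
  refine ⟨fun n w => JumpHalts n (List.replicate w.unpair.1 false) w.unpair.2, ?_,
    fun n => mem_jump_empty_iff⟩
  have hw := Primrec.unpair.comp (Primrec.snd (α := ℕ) (β := ℕ))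
  exact primrecPred_haltsWithin (Primrec.snd.comp hw) Primrec.fst
    (Primrec₂.natPair.comp Primrec.fst
      (Primrec.encode.comp (primrec_replicate_false.comp (Primrec.fst.comp hw))))

/-- `0''` is `Σ₂`. The outer witness codes an initial segment `σ` of `0'`, the length of a computation
that uses it, and a bound for the witnesses that show `k ∈ 0'` where `σ` says so. -/
theorem exists_primrec_jump_two :
    ∃ P : ℕ → ℕ → ℕ → Prop, (PrimrecPred fun a : ℕ × ℕ × ℕ => P a.1 a.2.1 a.2.2) ∧
      ∀ n, n ∈ turingJump (turingJump ∅) ↔ ∃ w, ∀ m, P n w m := by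
  obtain ⟨P, hP, hPe⟩ := exists_primrecRel_jump_one
  let D : ℕ → List Bool × ℕ × ℕ := fun w => (decode w).getD ([], 0, 0)
  have hD : Primrec D := Primrec.option_getD.comp Primrec.decode (Primrec.const _)
  have hDe : ∀ x, D (encode x) = x := fun x => by simp only [D, encodek, Option.getD_some]
  refine ⟨fun n w m => JumpHalts n (D w).1 (D w).2.1 ∧ ∀ k < (D w).1.length,
    ((D w).1[k]? = some true → ∃ j < (D w).2.2, P k j) ∧ ((D w).1[k]? = some false → ¬ P k m),
    ?_, fun n => ?_⟩
  · have hw : Primrec fun a : ℕ × ℕ × ℕ => D a.2.1 := hD.comp (Primrec.fst.comp Primrec.snd)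
    have h1 := Primrec.fst.comp hw
    refine PrimrecPred.and (primrecPred_haltsWithin (Primrec.fst.comp (Primrec.snd.comp hw))
      Primrec.fst (Primrec₂.natPair.comp Primrec.fst (Primrec.encode.comp h1)))
      (PrimrecPred.forall_lt_param (Primrec.list_length.comp h1) ?_)
    have hg := Primrec.list_getElem?.comp (h1.comp (Primrec.fst (β := ℕ))) Primrec.snd
    refine PrimrecPred.and (PrimrecPred.imp (Primrec.eq.comp hg (Primrec.const (some true)))
      (PrimrecPred.exists_lt_param (Primrec.snd.comp (Primrec.snd.comp (hw.comp Primrec.fst)))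
        (hP.comp (Primrec.snd.comp Primrec.fst) Primrec.snd)))
      (PrimrecPred.imp (Primrec.eq.comp hg (Primrec.const (some false)))
        (hP.comp Primrec.snd (Primrec.snd.comp (Primrec.snd.comp Primrec.fst))).not)
  · rw [mem_turingJump_iff]
    simp only [isInitialSegment_iff, hPe]
    constructor
    · rintro ⟨σ, u, hσ, hu⟩
      have : ∃ b, ∀ k < σ.length, σ[k]? = some true → ∃ j < b, P k j := by
        have : ∀ k, ∃ j, k < σ.length → σ[k]? = some true → P k j := by
          intro k
          by_cases hk : k < σ.length ∧ σ[k]? = some true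
          · obtain ⟨j, hj⟩ := (hσ k hk.1).1 hk.2
            exact ⟨j, fun _ _ => hj⟩
          · exact ⟨0, fun h1 h2 => absurd ⟨h1, h2⟩ hk⟩
        choose g hg using this
        refine ⟨(Finset.range σ.length).sup g + 1, fun k hk ht => ⟨g k, ?_, hg k hk ht⟩⟩
        exact Nat.lt_succ_of_le (Finset.le_sup (Finset.mem_range.2 hk))
      obtain ⟨b, hb⟩ := this
      refine ⟨encode (σ, u, b), fun m => ?_⟩
      rw [hDe]
      exact ⟨hu, fun k hk => ⟨hb k hk, fun hf hp => (hσ k hk).2 hf ⟨m, hp⟩⟩⟩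
    · rintro ⟨w, hw⟩
      refine ⟨(D w).1, (D w).2.1, fun k hk => ⟨fun ht => ?_, fun hf => ?_⟩, (hw 0).1⟩
      · obtain ⟨j, -, hj⟩ := ((hw 0).2 k hk).1 ht
        exact ⟨j, hj⟩
      · rintro ⟨m, hm⟩
        exact ((hw m).2 k hk).2 hf hm

/-- `0'''` is `Σ₃`. The outermost witness codes an initial segment `σ` of `0''`, the length of a
computation that uses it, and a list of the witnesses that show `k ∈ 0''` where `σ` says so. -/
theorem exists_primrec_jump_three :
    ∃ P : ℕ → ℕ → ℕ → ℕ → Prop,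
      (PrimrecPred fun a : ℕ × ℕ × ℕ × ℕ => P a.1 a.2.1 a.2.2.1 a.2.2.2) ∧
      ∀ n, n ∈ zeroTripleJump ↔ ∃ w, ∀ m, ∃ j, P n w m j := by
  obtain ⟨P, hP, hPe⟩ := exists_primrec_jump_two
  let D : ℕ → List Bool × ℕ × List ℕ := fun w => (decode w).getD ([], 0, [])
  have hD : Primrec D := Primrec.option_getD.comp Primrec.decode (Primrec.const _)
  have hDe : ∀ x, D (encode x) = x := fun x => by simp only [D, encodek, Option.getD_some]
  refine ⟨fun n w m j => JumpHalts n (D w).1 (D w).2.1 ∧ ∀ k < (D w).1.length,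
    ((D w).1[k]? = some true → P k ((D w).2.2.getD k 0) m) ∧
      ((D w).1[k]? = some false → ∃ i < j, ¬ P k m i), ?_, fun n => ?_⟩
  · have hw : Primrec fun a : ℕ × ℕ × ℕ × ℕ => D a.2.1 := hD.comp (Primrec.fst.comp Primrec.snd)
    have hm : Primrec fun a : ℕ × ℕ × ℕ × ℕ => a.2.2.1 :=
      Primrec.fst.comp (Primrec.snd.comp Primrec.snd)
    have hj : Primrec fun a : ℕ × ℕ × ℕ × ℕ => a.2.2.2 :=
      Primrec.snd.comp (Primrec.snd.comp Primrec.snd)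
    have h1 := Primrec.fst.comp hw
    refine PrimrecPred.and (primrecPred_haltsWithin (Primrec.fst.comp (Primrec.snd.comp hw))
      Primrec.fst (Primrec₂.natPair.comp Primrec.fst (Primrec.encode.comp h1)))
      (PrimrecPred.forall_lt_param (Primrec.list_length.comp h1) ?_)
    have hg := Primrec.list_getElem?.comp (h1.comp (Primrec.fst (β := ℕ))) Primrec.snd
    refine PrimrecPred.and (PrimrecPred.imp (Primrec.eq.comp hg (Primrec.const (some true)))
      (hP.comp (Primrec.snd.pair (Primrec.pair
        ((Primrec.list_getD 0).comp (Primrec.snd.comp (Primrec.snd.comp (hw.comp Primrec.fst)))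
          Primrec.snd) (hm.comp Primrec.fst)))))
      (PrimrecPred.imp (Primrec.eq.comp hg (Primrec.const (some false)))
        (PrimrecPred.exists_lt_param (hj.comp Primrec.fst) (PrimrecPred.not
          (hP.comp (Primrec.pair (Primrec.snd.comp Primrec.fst)
            (Primrec.pair (hm.comp (Primrec.fst.comp Primrec.fst)) Primrec.snd))))))
  · rw [zeroTripleJump, mem_turingJump_iff]
    simp only [isInitialSegment_iff, hPe]
    constructor
    · rintro ⟨σ, u, hσ, hu⟩
      have : ∀ k, ∃ w, k < σ.length → σ[k]? = some true → ∀ m, P k w m := by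
        intro k
        by_cases hk : k < σ.length ∧ σ[k]? = some true
        · obtain ⟨w, hw⟩ := (hσ k hk.1).1 hk.2
          exact ⟨w, fun _ _ => hw⟩
        · exact ⟨0, fun h1 h2 => absurd ⟨h1, h2⟩ hk⟩
      choose g hg using this
      refine ⟨encode (σ, u, (List.range σ.length).map g), fun m => ?_⟩
      rw [hDe]
      have : ∀ k, ∃ i, k < σ.length → σ[k]? = some false → ¬ P k m i := by
        intro k
        by_cases hk : k < σ.length ∧ σ[k]? = some false
        · have := (hσ k hk.1).2 hk.2
          push Not at this
          obtain ⟨i, hi⟩ := this m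
          exact ⟨i, fun _ _ => hi⟩
        · exact ⟨0, fun h1 h2 => absurd ⟨h1, h2⟩ hk⟩
      choose h hh using this
      refine ⟨(Finset.range σ.length).sup h + 1, hu, fun k hk => ⟨fun ht => ?_, fun hf =>
        ⟨h k, Nat.lt_succ_of_le (Finset.le_sup (Finset.mem_range.2 hk)), hh k hk hf⟩⟩⟩
      have : ((List.range σ.length).map g).getD k 0 = g k := by
        rw [List.getD_eq_getElem?_getD]
        simp [hk]
      simp only [this]
      exact hg k hk ht m
    · rintro ⟨w, hw⟩
      refine ⟨(D w).1, (D w).2.1, fun k hk => ⟨fun ht => ?_, fun hf => ?_⟩, ?_⟩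
      · refine ⟨(D w).2.2.getD k 0, fun m => ?_⟩
        obtain ⟨j, hj⟩ := hw m
        exact (hj.2 k hk).1 ht
      · rintro ⟨m, hm⟩
        obtain ⟨j, hj⟩ := hw m
        obtain ⟨i, -, hi⟩ := (hj.2 k hk).2 hf
        exact hi (hm i)
      · obtain ⟨j, hj⟩ := hw 0
        exact hj.1

/-- `0'''` is `Σ₃`, in the form in which it is used: `n ∈ 0'''` if and only if one of countably many
uniformly primitive recursive sets attached to `n` is infinite. -/
theorem exists_primrec_zeroTripleJump :
    ∃ P : ℕ → ℕ → ℕ → Prop, (PrimrecPred fun a : ℕ × ℕ × ℕ => P a.1 a.2.1 a.2.2) ∧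
      ∀ n, n ∈ zeroTripleJump ↔ ∃ w, {t | P n w t}.Infinite := by
  obtain ⟨P, hP, hPe⟩ := exists_primrec_jump_three
  refine ⟨fun n w t => (∀ i < t.unpair.1 + 1, ∃ j < t.unpair.2, P n w i j) ∧
      ¬ ∀ i < t.unpair.1 + 1, ∃ j < t.unpair.2 - 1, P n w i j, ?_, fun n => ?_⟩
  · have ht : Primrec fun a : ℕ × ℕ × ℕ => a.2.2.unpair :=
      Primrec.unpair.comp (Primrec.snd.comp Primrec.snd)
    have hb : PrimrecRel fun (x : (ℕ × ℕ × ℕ) × ℕ) (j : ℕ) => P x.1.1 x.1.2.1 x.2 j :=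
      hP.comp (Primrec.pair (Primrec.fst.comp (Primrec.fst.comp Primrec.fst)) (Primrec.pair
        (Primrec.fst.comp (Primrec.snd.comp (Primrec.fst.comp Primrec.fst)))
        (Primrec.pair (Primrec.snd.comp Primrec.fst) Primrec.snd)))
    have h1 := Primrec.succ.comp (Primrec.fst.comp ht)
    have h2 (g : ℕ → ℕ) (hg : Primrec g) : PrimrecPred fun a : ℕ × ℕ × ℕ =>
        ∀ i < a.2.2.unpair.1 + 1, ∃ j < g a.2.2.unpair.2, P a.1 a.2.1 i j := by
      refine PrimrecPred.forall_lt_param h1 (p := fun a i => ∃ j < g a.2.2.unpair.2,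
        P a.1 a.2.1 i j) ?_
      exact PrimrecPred.exists_lt_param (α := (ℕ × ℕ × ℕ) × ℕ)
        (hg.comp (Primrec.snd.comp (ht.comp Primrec.fst))) hb
    exact (h2 _ Primrec.id).and (h2 _ Primrec.pred).not
  · rw [hPe]
    exact exists_congr fun w => (infinite_setOf_least_bound _).symm

/-! ### Stagewise approximations of ceers -/

/-- `r s x` is the canonical (least) representative of the class of `x` in the `s`-th stage of an
approximation of the equivalence relation `E` from below, where only numbers below `s` are collapsed
by stage `s`. -/
structure IsApprox (r : ℕ → ℕ → ℕ) (E : Setoid ℕ) : Prop where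
  le : ∀ s x, r s x ≤ x
  idem : ∀ s x, r s (r s x) = r s x
  succ : ∀ s x, r (s + 1) (r s x) = r (s + 1) x
  fix : ∀ s x, s ≤ x → r s x = x
  spec : ∀ x y, E x y ↔ ∃ s, r s x = r s y

namespace IsApprox
variable {r : ℕ → ℕ → ℕ} {E : Setoid ℕ}

theorem comp (h : IsApprox r E) {s s' : ℕ} (hs : s ≤ s') (x : ℕ) : r s' (r s x) = r s' x := by
  induction s', hs using Nat.le_induction with
  | base => exact h.idem s x
  | succ n _ ih => rw [← h.succ, ih, h.succ]

theorem eq_of_le (h : IsApprox r E) {s s' x y : ℕ} (hs : s ≤ s') (hxy : r s x = r s y) :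
    r s' x = r s' y := by
  rw [← h.comp hs x, hxy, h.comp hs]

theorem rep_of_le (h : IsApprox r E) {s s' x : ℕ} (hs : s ≤ s') (hx : r s' x = x) :
    r s x = x := by
  refine le_antisymm (h.le s x) ?_
  conv_lhs => rw [← hx, ← h.comp hs]
  exact h.le _ _

end IsApprox

/-- The effect on `x` of a list of merges `(a, b)`, each sending `a` to `b`. -/
def applyMerges (L : List (ℕ × ℕ)) (x : ℕ) : ℕ :=
  L.foldl (fun y p => if y = p.1 then p.2 else y) x

theorem applyMerges_concat (L : List (ℕ × ℕ)) (p : ℕ × ℕ) (x : ℕ) :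
    applyMerges (L ++ [p]) x =
      if applyMerges L x = p.1 then p.2 else applyMerges L x := by
  simp only [applyMerges, List.foldl_append]
  rfl

instance (u e n : ℕ) : Decidable (HaltsWithin u e n) :=
  inferInstanceAs (Decidable (_ = true))

/-- One stage in the approximation of `E_e`. At the stage coding `⟨⟨a, b⟩, u⟩` the classes of `a` and
`b` are merged if `⟨a, b⟩` is seen to be in `W_e` within `u` steps. -/
def ceerMergesStep (e s : ℕ) (L : List (ℕ × ℕ)) : List (ℕ × ℕ) :=
  if HaltsWithin s.unpair.2 e s.unpair.1 then
    L ++ [(max (applyMerges L s.unpair.1.unpair.1) (applyMerges L s.unpair.1.unpair.2),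
      min (applyMerges L s.unpair.1.unpair.1) (applyMerges L s.unpair.1.unpair.2))]
  else L

/-- The merges made before stage `s` in the approximation of `E_e`. -/
def ceerMerges (e : ℕ) : ℕ → List (ℕ × ℕ)
  | 0 => []
  | s + 1 => ceerMergesStep e s (ceerMerges e s)

/-- The canonical representative of `x` in the `s`-th stage of the approximation of `E_e`. -/
def ceerRep (e s x : ℕ) : ℕ :=
  applyMerges (ceerMerges e s) x

theorem ceerRep_succ (e s x : ℕ) : ceerRep e (s + 1) x =
    if HaltsWithin s.unpair.2 e s.unpair.1 ∧ ceerRep e s x =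
        max (ceerRep e s s.unpair.1.unpair.1) (ceerRep e s s.unpair.1.unpair.2) then
      min (ceerRep e s s.unpair.1.unpair.1) (ceerRep e s s.unpair.1.unpair.2)
    else ceerRep e s x := by
  simp only [ceerRep, ceerMerges, ceerMergesStep]
  by_cases h : HaltsWithin s.unpair.2 e s.unpair.1
  · simp only [h, if_true, true_and]
    rw [applyMerges_concat]
  · simp only [h, if_false, false_and]

theorem primrec_applyMerges : Primrec₂ applyMerges :=
  Primrec.list_foldl Primrec.fst Primrec.snd
    (Primrec.ite (Primrec.eq.comp (Primrec.fst.comp Primrec.snd)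
        (Primrec.fst.comp (Primrec.snd.comp Primrec.snd)))
      (Primrec.snd.comp (Primrec.snd.comp Primrec.snd)) (Primrec.fst.comp Primrec.snd)).to₂

theorem primrec_ceerMerges (e : ℕ) : Primrec (ceerMerges e) := by
  have h : Primrec₂ (ceerMergesStep e) := by
    have hs := Primrec.unpair.comp (Primrec.fst (α := ℕ) (β := List (ℕ × ℕ)))
    have hab := Primrec.unpair.comp (Primrec.fst.comp hs)
    have ha := primrec_applyMerges.comp Primrec.snd (Primrec.fst.comp hab)
    have hb := primrec_applyMerges.comp Primrec.snd (Primrec.snd.comp hab)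
    exact Primrec.ite (primrecPred_haltsWithin (Primrec.snd.comp hs) (Primrec.const e)
      (Primrec.fst.comp hs)) (Primrec.list_concat.comp Primrec.snd
        (Primrec.pair (Primrec.nat_max.comp ha hb) (Primrec.nat_min.comp ha hb))) Primrec.snd
  refine (Primrec.nat_rec₁ [] h).of_eq fun s => ?_
  induction s with
  | zero => rfl
  | succ n ih => simp only [ceerMerges, ih]

theorem primrec_ceerRep (e : ℕ) : Primrec₂ (ceerRep e) :=
  primrec_applyMerges.comp ((primrec_ceerMerges e).comp Primrec.fst) Primrec.snd

theorem ceerRep_le (e s x : ℕ) : ceerRep e s x ≤ x := by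
  induction s with
  | zero => exact le_rfl
  | succ n ih =>
    rw [ceerRep_succ]
    split_ifs with h
    · have := h.2
      omega
    · exact ih

theorem ceerRep_idem (e s x : ℕ) : ceerRep e s (ceerRep e s x) = ceerRep e s x := by
  induction s generalizing x with
  | zero => rfl
  | succ n ih =>
    have hmin : ceerRep e n
        (min (ceerRep e n n.unpair.1.unpair.1) (ceerRep e n n.unpair.1.unpair.2)) =
        min (ceerRep e n n.unpair.1.unpair.1) (ceerRep e n n.unpair.1.unpair.2) := by
      rcases min_choice (ceerRep e n n.unpair.1.unpair.1) (ceerRep e n n.unpair.1.unpair.2)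
        with h | h <;> rw [h, ih]
    rw [ceerRep_succ e n x]
    split_ifs with h
    · rw [ceerRep_succ, hmin]
      split_ifs <;> rfl
    · rw [ceerRep_succ, ih, if_neg h]

theorem isApprox_ceerRep (e : ℕ) : IsApprox (ceerRep e) (ceer e) := by
  have hsucc : ∀ s x, ceerRep e (s + 1) (ceerRep e s x) = ceerRep e (s + 1) x := by
    intro s x
    rw [ceerRep_succ, ceerRep_idem, ← ceerRep_succ]
  have hmono : ∀ {s s' x y}, s ≤ s' → ceerRep e s x = ceerRep e s y →
      ceerRep e s' x = ceerRep e s' y := by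
    intro s s' x y hs h
    induction s', hs using Nat.le_induction with
    | base => exact h
    | succ n _ ih => rw [← hsucc, ih, hsucc]
  have hsound : ∀ s x, (ceer e) (ceerRep e s x) x := by
    intro s
    induction s with
    | zero => exact fun x => (ceer e).refl x
    | succ n ih =>
      intro x
      rw [ceerRep_succ]
      split_ifs with h
      · have hab : (ceer e) n.unpair.1.unpair.1 n.unpair.1.unpair.2 := by
          refine Relation.EqvGen.rel _ _ ?_
          rw [Nat.pair_unpair, mem_ceSet_iff]
          exact ⟨_, h.1⟩
        have hab' := (ceer e).trans ((ceer e).trans (ih _) hab) ((ceer e).symm (ih _))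
        refine (ceer e).trans ?_ (ih x)
        rw [h.2]
        rcases le_total (ceerRep e n n.unpair.1.unpair.1) (ceerRep e n n.unpair.1.unpair.2)
          with hle | hle
        · rw [min_eq_left hle, max_eq_right hle]
          exact hab'
        · rw [min_eq_right hle, max_eq_left hle]
          exact (ceer e).symm hab'
      · exact ih x
  refine ⟨ceerRep_le e, ceerRep_idem e, hsucc, ?_, fun x y => ⟨fun h => ?_, ?_⟩⟩
  · intro s
    induction s with
    | zero => exact fun x _ => rfl
    | succ n ih =>
      intro x hx
      have h1 := Nat.unpair_left_le n
      have h2 := Nat.unpair_left_le n.unpair.1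
      have h3 := Nat.unpair_right_le n.unpair.1
      have h4 := ceerRep_le e n n.unpair.1.unpair.1
      have h5 := ceerRep_le e n n.unpair.1.unpair.2
      rw [ceerRep_succ, ih x (by omega), if_neg]
      omega
  · have h' : Relation.EqvGen (fun x y => Nat.pair x y ∈ ceSet e) x y := h
    clear h
    induction h' with
    | rel x y h =>
      obtain ⟨u, hu⟩ := mem_ceSet_iff.1 h
      refine ⟨Nat.pair (Nat.pair x y) u + 1, ?_⟩
      rw [ceerRep_succ, ceerRep_succ]
      simp only [Nat.unpair_pair, hu, true_and]
      split_ifs <;> omega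
    | refl x => exact ⟨0, rfl⟩
    | symm x y _ ih =>
      obtain ⟨s, hs⟩ := ih
      exact ⟨s, hs.symm⟩
    | trans x y z _ _ ih1 ih2 =>
      obtain ⟨s, hs⟩ := ih1
      obtain ⟨s', hs'⟩ := ih2
      exact ⟨max s s', (hmono (le_max_left _ _) hs).trans (hmono (le_max_right _ _) hs')⟩
  · rintro ⟨s, hs⟩
    refine (ceer e).trans ((ceer e).symm (hsound s x)) ?_
    rw [hs]
    exact hsound s y

/-! ### Computable equivalence -/

theorem CompReducible.trans {E R T : Setoid ℕ} (h1 : CompReducible E R) (h2 : CompReducible R T) :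
    CompReducible E T := by
  obtain ⟨f, hf, hf'⟩ := h1
  obtain ⟨g, hg, hg'⟩ := h2
  exact ⟨g ∘ f, hg.comp hf, fun x y => (hf' x y).trans (hg' _ _)⟩

theorem CompEquiv.trans {E R T : Setoid ℕ} (h1 : CompEquiv E R) (h2 : CompEquiv R T) :
    CompEquiv E T :=
  ⟨h1.1.trans h2.1, h2.2.trans h1.2⟩

theorem CompEquiv.symm {E R : Setoid ℕ} (h : CompEquiv E R) : CompEquiv R E :=
  ⟨h.2, h.1⟩

/-- A total computably enumerable relation between numbers that matches `E` with `R` can be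
uniformized to a reduction of `E` to `R`. -/
theorem compReducible_of_matching {E R : Setoid ℕ} {M : ℕ → ℕ → ℕ → Prop}
    (hM : PrimrecPred fun a : ℕ × ℕ × ℕ => M a.1 a.2.1 a.2.2) (htot : ∀ x, ∃ t s, M x t s)
    (hER : ∀ {x t s x' t' s'}, M x t s → M x' t' s' → (E x x' ↔ R t t')) :
    CompReducible E R := by
  classical
  have htot' : ∀ x, ∃ w : ℕ, M x w.unpair.1 w.unpair.2 := by
    intro x
    obtain ⟨t, s, h⟩ := htot x
    exact ⟨Nat.pair t s, by simpa using h⟩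
  have hw := Primrec.unpair.comp (Primrec.snd (α := ℕ) (β := ℕ))
  have hb : Primrec₂ fun x w : ℕ => decide (M x w.unpair.1 w.unpair.2) :=
    (hM.comp (Primrec.fst.pair ((Primrec.fst.comp hw).pair (Primrec.snd.comp hw)))).decide
  have hfind : Computable fun x => Nat.find (htot' x) := by
    refine Partrec.of_eq (Partrec.rfind hb.to_comp.partrec₂) fun x => ?_
    refine Part.eq_some_iff.2 (Nat.mem_rfind.2 ⟨?_, fun {m} hm => ?_⟩)
    · simpa using Nat.find_spec (htot' x)
    · simpa using Nat.find_min (htot' x) hm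
  refine ⟨fun x => (Nat.find (htot' x)).unpair.1,
    (Primrec.fst.comp Primrec.unpair).to_comp.comp hfind, fun x y => ?_⟩
  exact hER (Nat.find_spec (htot' x)) (Nat.find_spec (htot' y))

/-! ### Lists of canonical representatives -/

/-- The fixed points of `ρ` below `n`, in increasing order; for a stage `ρ` of an approximation these
are the canonical representatives below `n`. -/
def repList (ρ : ℕ → ℕ) (n : ℕ) : List ℕ :=
  (List.range n).filter (fun x => ρ x = x)

/-- The number of fixed points of `ρ` below `n`. For a fixed point `n`, this is its index in the
increasing enumeration of all fixed points. -/
def repCount (ρ : ℕ → ℕ) (n : ℕ) : ℕ :=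
  (repList ρ n).length

section RepList
variable {ρ ρ' : ℕ → ℕ}

theorem repList_succ (ρ : ℕ → ℕ) (n : ℕ) :
    repList ρ (n + 1) = repList ρ n ++ (if ρ n = n then [n] else []) := by
  simp only [repList, List.range_succ, List.filter_append]
  congr 1
  by_cases h : ρ n = n <;> simp [h]

theorem repCount_succ (ρ : ℕ → ℕ) (n : ℕ) :
    repCount ρ (n + 1) = repCount ρ n + if ρ n = n then 1 else 0 := by
  simp only [repCount, repList_succ, List.length_append]
  split_ifs <;> rfl

theorem repCount_eq_count (ρ : ℕ → ℕ) (n : ℕ) :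
    repCount ρ n = Nat.count (fun x => ρ x = x) n := by
  induction n with
  | zero => simp [repCount, repList]
  | succ n ih => rw [repCount_succ, Nat.count_succ, ih]

theorem repCount_mono (ρ : ℕ → ℕ) {m n : ℕ} (h : m ≤ n) : repCount ρ m ≤ repCount ρ n := by
  rw [repCount_eq_count, repCount_eq_count]
  exact Nat.count_monotone _ h

theorem repCount_lt {m n : ℕ} (hm : ρ m = m) (h : m < n) : repCount ρ m < repCount ρ n := by
  refine lt_of_lt_of_le ?_ (repCount_mono ρ (Nat.succ_le_of_lt h))
  rw [repCount_succ, if_pos hm]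
  omega

theorem repCount_injOn {m n : ℕ} (hm : ρ m = m) (hn : ρ n = n) (h : repCount ρ m = repCount ρ n) :
    m = n := by
  rcases lt_trichotomy m n with hlt | heq | hgt
  · have := repCount_lt hm hlt
    omega
  · exact heq
  · have := repCount_lt hn hgt
    omega

theorem repCount_congr {n : ℕ} (h : ∀ x < n, ρ x = ρ' x) : repCount ρ n = repCount ρ' n := by
  induction n with
  | zero => rfl
  | succ n ih =>
    rw [repCount_succ, repCount_succ, ih fun x hx => h x (by omega), h n (by omega)]

theorem repCount_anti (h : ∀ x, ρ x = x → ρ' x = x) (n : ℕ) : repCount ρ n ≤ repCount ρ' n := by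
  induction n with
  | zero => rfl
  | succ n ih =>
    rw [repCount_succ, repCount_succ]
    by_cases hn : ρ n = n
    · rw [if_pos hn, if_pos (h n hn)]
      omega
    · rw [if_neg hn]
      omega

theorem le_repCount_add {s : ℕ} (h : ∀ x, s ≤ x → ρ x = x) (m : ℕ) : m ≤ repCount ρ (s + m) := by
  induction m with
  | zero => omega
  | succ m ih =>
    rw [← Nat.add_assoc, repCount_succ, if_pos (h _ (by omega))]
    omega

theorem getElem?_repList_eq_some {n i y : ℕ} :
    (repList ρ n)[i]? = some y ↔ ρ y = y ∧ y < n ∧ repCount ρ y = i := by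
  have h1 : ∀ n y, ρ y = y → y < n → (repList ρ n)[repCount ρ y]? = some y := by
    intro n
    induction n with
    | zero => intro y _ hy; omega
    | succ n ih =>
      intro y hy hyn
      rw [repList_succ]
      rcases Nat.lt_succ_iff_lt_or_eq.1 hyn with hlt | rfl
      · rw [List.getElem?_append_left (repCount_lt hy hlt)]
        exact ih y hy hlt
      · rw [repCount, List.getElem?_append_right le_rfl, if_pos hy]
        simp
  constructor
  · intro h
    have hmem := List.mem_of_getElem? h
    simp only [repList, List.mem_filter, List.mem_range, decide_eq_true_eq] at hmem
    have h2 := h1 n y hmem.2 hmem.1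
    refine ⟨hmem.2, hmem.1, ?_⟩
    have hnd : (repList ρ n).Nodup := List.nodup_range.filter _
    obtain ⟨hi, hi'⟩ := List.getElem?_eq_some_iff.1 h
    obtain ⟨hj, hj'⟩ := List.getElem?_eq_some_iff.1 h2
    exact (hnd.getElem_inj_iff (hi := hj) (hj := hi)).1 (hj'.trans hi'.symm)
  · rintro ⟨hy, hyn, rfl⟩
    exact h1 n y hy hyn

theorem drop_repList (ρ : ℕ → ℕ) (p n : ℕ) :
    (repList ρ n).drop p = (List.range n).filter (fun x => ρ x = x ∧ p ≤ repCount ρ x) := by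
  induction n with
  | zero => simp [repList]
  | succ n ih =>
    rw [repList_succ, List.drop_append, ih, List.range_succ, List.filter_append]
    congr 1
    change List.drop (p - repCount ρ n) _ = _
    by_cases h : ρ n = n
    · by_cases hp : p ≤ repCount ρ n
      · simp [h, hp]
      · have : 1 ≤ p - repCount ρ n := by omega
        simp [h, hp, this]
    · simp [h]

theorem repList_append_of_le (ρ : ℕ → ℕ) {m n : ℕ} (h : m ≤ n) :
    ∃ T, repList ρ n = repList ρ m ++ T := by
  induction n, h using Nat.le_induction with
  | base => exact ⟨[], by simp⟩
  | succ n _ ih =>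
    obtain ⟨T, hT⟩ := ih
    exact ⟨_, by rw [repList_succ, hT, List.append_assoc]⟩

end RepList

/-! ### The dynamic construction -/

/-- The entries of a stack that belong to strategies of index below `k`. An entry `(c, k, x)` means
that the number `c` is used by the strategy `k` as the image of `x`. -/
def lowerPart (k : ℕ) (L : List (ℕ × ℕ × ℕ)) : List (ℕ × ℕ × ℕ) :=
  L.filter (fun e => e.2.1 < k)

/-- The entries of a stack that belong to the strategy `k`. -/
def ownPart (k : ℕ) (L : List (ℕ × ℕ × ℕ)) : List (ℕ × ℕ × ℕ) :=
  L.filter (fun e => e.2.1 = k)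

/-- The part of the stack that survives an action of the strategy `k`: the entries of stronger
strategies, and those own entries `(c, k, x)` for which `x` still is a representative and is not
among the first `p` representatives, which are matched with the `p` entries of the stronger
strategies. -/
def keptPart (ρ : ℕ → ℕ) (k : ℕ) (L : List (ℕ × ℕ × ℕ)) : List (ℕ × ℕ × ℕ) :=
  lowerPart k L ++ (ownPart k L).filter
    (fun e => ρ e.2.2 = e.2.2 ∧ (lowerPart k L).length ≤ repCount ρ e.2.2)

/-- The stack after an action of the strategy `k` at stage `s`: the new number `s` becomes the image
of the first representative that is not yet matched. The bound `s + length + 1` suffices to find it,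
since all numbers from `s` on are representatives at stage `s`. -/
def nextStack (ρ : ℕ → ℕ) (k s : ℕ) (L : List (ℕ × ℕ × ℕ)) : List (ℕ × ℕ × ℕ) :=
  keptPart ρ k L ++
    [(s, k, (repList ρ (s + (keptPart ρ k L).length + 1)).getD (keptPart ρ k L).length 0)]

/-- Where the class of the number `c` goes when the strategy `k` acts at stage `s`. Numbers in the
new stack stay; a number which was the image of `x` for the strategy `k` joins the number at the
position of the current representative of `x`; numbers of weaker strategies join `s`. -/
def moveClass (ρ : ℕ → ℕ) (k s : ℕ) (L : List (ℕ × ℕ × ℕ)) (c : ℕ) : ℕ :=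
  if c ∈ (nextStack ρ k s L).map Prod.fst ∨ s < c then c
  else ((((L.filter (fun e => e.1 = c ∧ e.2.1 = k)).head?).bind
    (fun e => (nextStack ρ k s L)[repCount ρ (ρ e.2.2)]?)).map Prod.fst).getD s

/-- The stack before stage `s`, when the strategy `v s` acts at stage `s` and the strategy `k` builds
a copy of the equivalence relation approximated by `r k`. -/
def stackAt (r : ℕ → ℕ → ℕ → ℕ) (v : ℕ → ℕ) : ℕ → List (ℕ × ℕ × ℕ)
  | 0 => []
  | s + 1 => nextStack (r (v s) s) (v s) s (stackAt r v s)

/-- The representative, before stage `s`, of the class of `t` in the constructed equivalence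
relation. -/
def dynRep (r : ℕ → ℕ → ℕ → ℕ) (v : ℕ → ℕ) : ℕ → ℕ → ℕ
  | 0, t => t
  | s + 1, t => moveClass (r (v s) s) (v s) s (stackAt r v s) (dynRep r v s t)

theorem dynRep_eq_of_le {r : ℕ → ℕ → ℕ → ℕ} {v : ℕ → ℕ} {s s' t t' : ℕ} (hs : s ≤ s')
    (h : dynRep r v s t = dynRep r v s t') : dynRep r v s' t = dynRep r v s' t' := by
  induction s', hs using Nat.le_induction with
  | base => exact h
  | succ n _ ih => simp only [dynRep, ih]

/-- The equivalence relation constructed in the limit. -/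
def dynSetoid (r : ℕ → ℕ → ℕ → ℕ) (v : ℕ → ℕ) : Setoid ℕ where
  r t t' := ∃ s, dynRep r v s t = dynRep r v s t'
  iseqv := ⟨fun _ => ⟨0, rfl⟩, fun ⟨s, hs⟩ => ⟨s, hs.symm⟩, fun ⟨s, hs⟩ ⟨s', hs'⟩ =>
    ⟨max s s', (dynRep_eq_of_le (le_max_left _ _) hs).trans
      (dynRep_eq_of_le (le_max_right _ _) hs')⟩⟩

/-! ### The construction is primitive recursive -/

section Primrec
variable {α : Type*} [Primcodable α]

theorem primrec_repList {ρ : α → ℕ → ℕ} {n : α → ℕ} (hρ : Primrec₂ ρ) (hn : Primrec n) :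
    Primrec fun a => repList (ρ a) (n a) :=
  Primrec.filter_param (p := fun a x => ρ a x = x) (Primrec.list_range.comp hn)
    (Primrec.eq.comp (hρ.comp Primrec.fst Primrec.snd) Primrec.snd)

theorem primrec_repCount {ρ : α → ℕ → ℕ} {n : α → ℕ} (hρ : Primrec₂ ρ) (hn : Primrec n) :
    Primrec fun a => repCount (ρ a) (n a) :=
  Primrec.list_length.comp (primrec_repList hρ hn)

variable {ρ : α → ℕ → ℕ} {k s c : α → ℕ} {L : α → List (ℕ × ℕ × ℕ)}

theorem primrec_keptPart (hρ : Primrec₂ ρ) (hk : Primrec k) (hL : Primrec L) :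
    Primrec fun a => keptPart (ρ a) (k a) (L a) := by
  have hlow : Primrec fun a => lowerPart (k a) (L a) :=
    Primrec.filter_param (p := fun a (e : ℕ × ℕ × ℕ) => e.2.1 < k a) hL
      (Primrec.nat_lt.comp (Primrec.fst.comp (Primrec.snd.comp Primrec.snd)) (hk.comp Primrec.fst))
  have hown : Primrec fun a => ownPart (k a) (L a) :=
    Primrec.filter_param (p := fun a (e : ℕ × ℕ × ℕ) => e.2.1 = k a) hL
      (Primrec.eq.comp (Primrec.fst.comp (Primrec.snd.comp Primrec.snd)) (hk.comp Primrec.fst))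
  have hx : Primrec fun x : α × (ℕ × ℕ × ℕ) => x.2.2.2 :=
    Primrec.snd.comp (Primrec.snd.comp Primrec.snd)
  have hρ' : Primrec₂ fun (x : α × (ℕ × ℕ × ℕ)) (y : ℕ) => ρ x.1 y :=
    hρ.comp (Primrec.fst.comp Primrec.fst) Primrec.snd
  exact Primrec.list_append.comp hlow (Primrec.filter_param
    (p := fun a (e : ℕ × ℕ × ℕ) => ρ a e.2.2 = e.2.2 ∧
      (lowerPart (k a) (L a)).length ≤ repCount (ρ a) e.2.2) hown
    ((Primrec.eq.comp (hρ.comp Primrec.fst hx) hx).and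
      (Primrec.nat_le.comp (Primrec.list_length.comp (hlow.comp Primrec.fst))
        (primrec_repCount hρ' hx))))

theorem primrec_nextStack (hρ : Primrec₂ ρ) (hk : Primrec k) (hs : Primrec s) (hL : Primrec L) :
    Primrec fun a => nextStack (ρ a) (k a) (s a) (L a) := by
  have hkept := primrec_keptPart hρ hk hL
  have hlen := Primrec.list_length.comp hkept
  exact Primrec.list_concat.comp hkept (hs.pair (hk.pair ((Primrec.list_getD 0).comp
    (primrec_repList hρ (Primrec.succ.comp (Primrec.nat_add.comp hs hlen))) hlen)))

theorem primrec_moveClass (hρ : Primrec₂ ρ) (hk : Primrec k) (hs : Primrec s) (hL : Primrec L)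
    (hc : Primrec c) : Primrec fun a => moveClass (ρ a) (k a) (s a) (L a) (c a) := by
  have hnext := primrec_nextStack hρ hk hs hL
  have hmem : PrimrecPred fun a => c a ∈ (nextStack (ρ a) (k a) (s a) (L a)).map Prod.fst :=
    ((PrimrecRel.exists_mem_list (R := fun x y : ℕ => x = y) Primrec.eq).comp
      (Primrec.list_map hnext (Primrec.fst.comp Primrec.snd).to₂) hc).of_eq fun a => by simp
  have hfil : Primrec fun a => (L a).filter (fun e => e.1 = c a ∧ e.2.1 = k a) :=
    Primrec.filter_param (p := fun a (e : ℕ × ℕ × ℕ) => e.1 = c a ∧ e.2.1 = k a) hL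
      ((Primrec.eq.comp (Primrec.fst.comp Primrec.snd) (hc.comp Primrec.fst)).and
        (Primrec.eq.comp (Primrec.fst.comp (Primrec.snd.comp Primrec.snd)) (hk.comp Primrec.fst)))
  have hx : Primrec fun x : α × (ℕ × ℕ × ℕ) => x.2.2.2 :=
    Primrec.snd.comp (Primrec.snd.comp Primrec.snd)
  have hρ' : Primrec₂ fun (x : α × (ℕ × ℕ × ℕ)) (y : ℕ) => ρ x.1 y :=
    hρ.comp (Primrec.fst.comp Primrec.fst) Primrec.snd
  have hget : Primrec₂ fun (a : α) (e : ℕ × ℕ × ℕ) =>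
      (nextStack (ρ a) (k a) (s a) (L a))[repCount (ρ a) (ρ a e.2.2)]? :=
    Primrec.list_getElem?.comp (hnext.comp Primrec.fst)
      (primrec_repCount hρ' (hρ.comp Primrec.fst hx))
  exact Primrec.ite (hmem.or (Primrec.nat_lt.comp hs hc)) hc
    (Primrec.option_getD.comp (Primrec.option_map (Primrec.option_bind
      (Primrec.list_head?.comp hfil) hget) (Primrec.fst.comp Primrec.snd).to₂) hs)

variable {r : ℕ → ℕ → ℕ → ℕ} {v : α → ℕ → ℕ}

theorem primrec_stackAt (hr : Primrec fun a : ℕ × ℕ × ℕ => r a.1 a.2.1 a.2.2) (hv : Primrec₂ v) :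
    Primrec₂ fun a s => stackAt r (v a) s := by
  have hs : Primrec fun x : α × (ℕ × List (ℕ × ℕ × ℕ)) => x.2.1 := Primrec.fst.comp Primrec.snd
  have hvs : Primrec fun x : α × (ℕ × List (ℕ × ℕ × ℕ)) => v x.1 x.2.1 :=
    hv.comp Primrec.fst hs
  have hstep : Primrec₂ fun (a : α) (x : ℕ × List (ℕ × ℕ × ℕ)) =>
      nextStack (r (v a x.1) x.1) (v a x.1) x.1 x.2 :=
    primrec_nextStack (α := α × (ℕ × List (ℕ × ℕ × ℕ))) (ρ := fun x => r (v x.1 x.2.1) x.2.1)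
      (hr.comp ((hvs.comp Primrec.fst).pair ((hs.comp Primrec.fst).pair Primrec.snd)))
      hvs hs (Primrec.snd.comp Primrec.snd)
  refine Primrec₂.of_eq (Primrec.nat_rec (Primrec.const []) hstep) fun a s => ?_
  induction s with
  | zero => rfl
  | succ n ih => simp only [stackAt, ← ih]

theorem primrec_dynRep (hr : Primrec fun a : ℕ × ℕ × ℕ => r a.1 a.2.1 a.2.2) (hv : Primrec₂ v) :
    Primrec fun x : α × ℕ × ℕ => dynRep r (v x.1) x.2.1 x.2.2 := by
  have ha : Primrec fun x : (α × ℕ × ℕ) × (ℕ × ℕ) => x.1.1 := Primrec.fst.comp Primrec.fst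
  have hs : Primrec fun x : (α × ℕ × ℕ) × (ℕ × ℕ) => x.2.1 := Primrec.fst.comp Primrec.snd
  have hvs : Primrec fun x : (α × ℕ × ℕ) × (ℕ × ℕ) => v x.1.1 x.2.1 := hv.comp ha hs
  have hstep : Primrec₂ fun (a : α × ℕ × ℕ) (x : ℕ × ℕ) =>
      moveClass (r (v a.1 x.1) x.1) (v a.1 x.1) x.1 (stackAt r (v a.1) x.1) x.2 :=
    primrec_moveClass (α := (α × ℕ × ℕ) × (ℕ × ℕ)) (ρ := fun x => r (v x.1.1 x.2.1) x.2.1)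
      (hr.comp ((hvs.comp Primrec.fst).pair ((hs.comp Primrec.fst).pair Primrec.snd)))
      hvs hs ((primrec_stackAt hr hv).comp ha hs) (Primrec.snd.comp Primrec.snd)
  refine (Primrec.nat_rec' (Primrec.fst.comp Primrec.snd) (Primrec.snd.comp Primrec.snd)
    hstep).of_eq fun x => ?_
  induction x.2.1 with
  | zero => rfl
  | succ n ih => simp only [dynRep, ← ih]

end Primrec

/-! ### General properties of the construction -/

theorem nodup_map_filter_append_filter {L : List (ℕ × ℕ × ℕ)} {p q : ℕ × ℕ × ℕ → Prop}
    [DecidablePred p] [DecidablePred q] (hL : (L.map Prod.fst).Nodup) (hpq : ∀ e, p e → ¬ q e) :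
    ((L.filter (p ·) ++ L.filter (q ·)).map Prod.fst).Nodup := by
  rw [List.map_append, List.nodup_append]
  refine ⟨hL.sublist (List.filter_sublist.map _), hL.sublist (List.filter_sublist.map _), ?_⟩
  intro a ha b hb hab
  simp only [List.mem_map, List.mem_filter, decide_eq_true_eq] at ha hb
  obtain ⟨e, ⟨he, hpe⟩, rfl⟩ := ha
  obtain ⟨e', ⟨he', hqe⟩, rfl⟩ := hb
  rw [List.inj_on_of_nodup_map hL he he' hab] at hpe
  exact hpq _ hpe hqe

theorem mem_lowerPart {k : ℕ} {L : List (ℕ × ℕ × ℕ)} {e : ℕ × ℕ × ℕ} :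
    e ∈ lowerPart k L ↔ e ∈ L ∧ e.2.1 < k := by
  simp [lowerPart]

theorem mem_ownPart {k : ℕ} {L : List (ℕ × ℕ × ℕ)} {e : ℕ × ℕ × ℕ} :
    e ∈ ownPart k L ↔ e ∈ L ∧ e.2.1 = k := by
  simp [ownPart]

theorem mem_keptPart {ρ : ℕ → ℕ} {k : ℕ} {L : List (ℕ × ℕ × ℕ)} {e : ℕ × ℕ × ℕ} :
    e ∈ keptPart ρ k L ↔ e ∈ L ∧ (e.2.1 < k ∨ e.2.1 = k ∧ ρ e.2.2 = e.2.2 ∧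
      (lowerPart k L).length ≤ repCount ρ e.2.2) := by
  simp only [keptPart, List.mem_append, List.mem_filter, mem_lowerPart, mem_ownPart,
    decide_eq_true_eq]
  tauto

theorem mem_nextStack {ρ : ℕ → ℕ} {k s : ℕ} {L : List (ℕ × ℕ × ℕ)} {e : ℕ × ℕ × ℕ}
    (h : e ∈ nextStack ρ k s L) : e ∈ keptPart ρ k L ∨ e.1 = s ∧ e.2.1 = k := by
  rcases List.mem_append.1 h with h | h
  · exact Or.inl h
  · rw [List.mem_singleton] at h
    subst h
    exact Or.inr ⟨rfl, rfl⟩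

theorem self_mem_nextStack (ρ : ℕ → ℕ) (k s : ℕ) (L : List (ℕ × ℕ × ℕ)) :
    s ∈ (nextStack ρ k s L).map Prod.fst := by
  simp [nextStack]

theorem moveClass_of_mem {ρ : ℕ → ℕ} {k s c : ℕ} {L : List (ℕ × ℕ × ℕ)}
    (h : c ∈ (nextStack ρ k s L).map Prod.fst) : moveClass ρ k s L c = c :=
  if_pos (Or.inl h)

theorem moveClass_mem {ρ : ℕ → ℕ} {k s c : ℕ} {L : List (ℕ × ℕ × ℕ)} (hc : c ≤ s) :
    moveClass ρ k s L c ∈ (nextStack ρ k s L).map Prod.fst := by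
  rw [moveClass]
  split_ifs with h
  · exact h.resolve_right (by omega)
  · generalize ho : Option.map Prod.fst (((L.filter (fun e => e.1 = c ∧ e.2.1 = k)).head?).bind
      (fun e => (nextStack ρ k s L)[repCount ρ (ρ e.2.2)]?)) = o
    cases o with
    | none => exact self_mem_nextStack ρ k s L
    | some a =>
      obtain ⟨e, he, rfl⟩ := Option.map_eq_some_iff.1 ho
      obtain ⟨e', -, he'⟩ := Option.bind_eq_some_iff.1 he
      exact List.mem_map_of_mem (List.mem_of_getElem? he')

section General
variable {r : ℕ → ℕ → ℕ → ℕ} {v : ℕ → ℕ}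

theorem fst_lt_of_mem_stackAt {s : ℕ} : ∀ e ∈ stackAt r v s, e.1 < s := by
  induction s with
  | zero => intro e he; simp [stackAt] at he
  | succ s ih =>
    intro e he
    rcases mem_nextStack he with h | h
    · have := ih e (mem_keptPart.1 h).1
      omega
    · omega

theorem lt_of_mem_map_stackAt {s c : ℕ} (h : c ∈ (stackAt r v s).map Prod.fst) : c < s := by
  obtain ⟨e, he, rfl⟩ := List.mem_map.1 h
  exact fst_lt_of_mem_stackAt e he

theorem nodup_stackAt (s : ℕ) : ((stackAt r v s).map Prod.fst).Nodup := by
  induction s with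
  | zero => simp [stackAt]
  | succ s ih =>
    rw [stackAt, nextStack, List.map_append, List.nodup_append]
    refine ⟨?_, by simp, ?_⟩
    · rw [keptPart, ownPart, List.filter_filter]
      simp only [← Bool.decide_and]
      refine nodup_map_filter_append_filter ih fun e h1 h2 => ?_
      have := h2.2
      omega
    · intro a ha b hb hab
      obtain ⟨e, he, rfl⟩ := List.mem_map.1 ha
      have := fst_lt_of_mem_stackAt e (mem_keptPart.1 he).1
      simp at hb
      omega

theorem eq_of_mem_stackAt {s : ℕ} {e e' : ℕ × ℕ × ℕ} (he : e ∈ stackAt r v s)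
    (he' : e' ∈ stackAt r v s) (h : e.1 = e'.1) : e = e' :=
  List.inj_on_of_nodup_map (nodup_stackAt s) he he' h

theorem dynRep_of_le {s t : ℕ} (h : s ≤ t) : dynRep r v s t = t := by
  induction s with
  | zero => rfl
  | succ s ih =>
    rw [dynRep, ih (by omega), moveClass, if_pos (Or.inr (by omega))]

theorem dynRep_mem {s t : ℕ} (h : t < s) : dynRep r v s t ∈ (stackAt r v s).map Prod.fst := by
  induction s with
  | zero => omega
  | succ s ih =>
    rw [dynRep, stackAt]
    refine moveClass_mem ?_
    rcases Nat.lt_succ_iff_lt_or_eq.1 h with h | rfl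
    · exact (lt_of_mem_map_stackAt (ih h)).le
    · exact (dynRep_of_le le_rfl).le

theorem dynRep_of_mem {s c : ℕ} (h : c ∈ (stackAt r v s).map Prod.fst) : dynRep r v s c = c := by
  induction s with
  | zero => rfl
  | succ s ih =>
    have hc : dynRep r v s c = c := by
      obtain ⟨e, he, rfl⟩ := List.mem_map.1 h
      rcases mem_nextStack he with h' | h'
      · exact ih (List.mem_map_of_mem (mem_keptPart.1 h').1)
      · exact dynRep_of_le h'.1.ge
    rw [dynRep, hc]
    exact moveClass_of_mem h

end General

/-! ### An action of a strategy -/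

section Action
variable {ρ ρ' : ℕ → ℕ} {k k' s : ℕ} {L : List (ℕ × ℕ × ℕ)}

theorem lowerPart_nextStack (h : k ≤ k') : lowerPart k (nextStack ρ k' s L) = lowerPart k L := by
  simp only [nextStack, keptPart, lowerPart, ownPart, List.filter_append, List.filter_filter]
  have h1 : L.filter (fun e => decide (e.2.1 < k) && decide (e.2.1 < k')) =
      L.filter (fun e => e.2.1 < k) := by
    refine List.filter_congr fun e _ => ?_
    rw [← Bool.decide_and]
    exact decide_eq_decide.2 (by omega)
  rw [h1]
  simp only [List.append_assoc]
  conv_rhs => rw [← List.append_nil (L.filter _)]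
  congr 1
  rw [List.append_eq_nil_iff]
  constructor
  · rw [List.filter_eq_nil_iff]
    intro e _
    simp only [Bool.and_eq_true, decide_eq_true_eq]
    omega
  · simp [h]

theorem ownPart_nextStack_of_lt (h : k < k') :
    ownPart k (nextStack ρ k' s L) = ownPart k L := by
  simp only [nextStack, keptPart, lowerPart, ownPart, List.filter_append, List.filter_filter]
  have h1 : L.filter (fun e => decide (e.2.1 = k) && decide (e.2.1 < k')) =
      L.filter (fun e => e.2.1 = k) := by
    refine List.filter_congr fun e _ => ?_
    rw [← Bool.decide_and]
    exact decide_eq_decide.2 (by omega)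
  rw [h1]
  simp only [List.append_assoc]
  conv_rhs => rw [← List.append_nil (L.filter _)]
  congr 1
  rw [List.append_eq_nil_iff]
  constructor
  · rw [List.filter_eq_nil_iff]
    intro e _
    simp only [Bool.and_eq_true, decide_eq_true_eq]
    omega
  · simp [h.ne']

theorem lowerPart_append_ownPart_nextStack :
    lowerPart k (nextStack ρ k s L) ++ ownPart k (nextStack ρ k s L) = nextStack ρ k s L := by
  rw [lowerPart_nextStack le_rfl]
  conv_rhs => rw [nextStack, keptPart, List.append_assoc]
  congr 1
  rw [nextStack, keptPart, List.append_assoc, ownPart, List.filter_append]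
  have h1 : (lowerPart k L).filter (fun e => e.2.1 = k) = [] := by
    rw [List.filter_eq_nil_iff]
    intro e he
    simp only [lowerPart, List.mem_filter, decide_eq_true_eq] at he ⊢
    omega
  rw [h1, List.nil_append, List.filter_eq_self.2]
  intro e he
  simp only [ownPart, List.mem_append, List.mem_filter, List.mem_singleton] at he
  rcases he with he | rfl
  · exact he.1.2
  · simp

/-- If the own entries of strategy `k` list the representatives below `B`, without the first `p`
which are matched with the entries of stronger strategies, then they do so for a larger bound after
the strategy has acted. -/
theorem ownPart_nextStack_labels (hfix : ∀ x, s ≤ x → ρ x = x) (hρ : ∀ x, ρ x = x → ρ' x = x)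
    {p B : ℕ} (hp : (lowerPart k L).length = p)
    (hB : (ownPart k L).map (·.2.2) = (repList ρ' B).drop p) :
    ∃ B', B < B' ∧ p < repCount ρ B' ∧
      (ownPart k (nextStack ρ k s L)).map (·.2.2) = (repList ρ B').drop p := by
  have hkept : ((ownPart k L).filter
      (fun e => ρ e.2.2 = e.2.2 ∧ p ≤ repCount ρ e.2.2)).map (·.2.2) = (repList ρ B).drop p := by
    have h1 : ((ownPart k L).filter (fun e => ρ e.2.2 = e.2.2 ∧ p ≤ repCount ρ e.2.2)).map
        (·.2.2) = ((ownPart k L).map (·.2.2)).filter (fun x => ρ x = x ∧ p ≤ repCount ρ x) := by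
      rw [List.filter_map]
      rfl
    rw [h1, hB, drop_repList, drop_repList, List.filter_filter]
    refine List.filter_congr fun x _ => ?_
    rw [← Bool.decide_and]
    refine decide_eq_decide.2 ⟨fun h => h.1, fun h => ⟨h, hρ x h.1, ?_⟩⟩
    exact h.2.trans (repCount_anti hρ x)
  have hlen : (keptPart ρ k L).length = p + (repCount ρ B - p) := by
    rw [keptPart, List.length_append, hp]
    congr 1
    have := congrArg List.length hkept
    rwa [List.length_map, List.length_drop] at this
  obtain ⟨y, hy⟩ : ∃ y, (repList ρ (s + (keptPart ρ k L).length + 1))[(keptPart ρ k L).length]? =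
      some y := by
    have := le_repCount_add hfix ((keptPart ρ k L).length + 1)
    exact ⟨_, List.getElem?_eq_getElem (show _ < (repList ρ _).length from this)⟩
  have hown : ownPart k (nextStack ρ k s L) = (ownPart k L).filter
      (fun e => ρ e.2.2 = e.2.2 ∧ p ≤ repCount ρ e.2.2) ++ [(s, k, y)] := by
    have h := lowerPart_append_ownPart_nextStack (ρ := ρ) (k := k) (s := s) (L := L)
    rw [lowerPart_nextStack le_rfl] at h
    conv_rhs at h => rw [nextStack, keptPart, List.append_assoc]
    rw [List.append_cancel_left h, hp, List.getD_eq_getElem?_getD, ← hp]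
    rw [keptPart] at hy
    rw [hy]
    rfl
  rw [getElem?_repList_eq_some, hlen] at hy
  have hBy : B ≤ y := by
    by_contra hlt
    have := repCount_lt hy.1 (not_le.1 hlt)
    omega
  refine ⟨y + 1, by omega, ?_, ?_⟩
  · rw [repCount_succ, if_pos hy.1]
    omega
  · obtain ⟨T, hT⟩ := repList_append_of_le ρ hBy
    have hTlen : repCount ρ y = repCount ρ B + T.length := by
      simp only [repCount, hT, List.length_append]
    rw [hown, List.map_append, hkept, repList_succ, if_pos hy.1,
      List.drop_append_of_le_length (show p ≤ repCount ρ y by omega), hT, List.drop_append]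
    have : List.drop (p - (repList ρ B).length) T = [] := by
      rw [List.drop_eq_nil_iff]
      change _ ≤ p - repCount ρ B
      omega
    rw [this, List.append_nil]
    rfl

end Action

/-! ### Stabilization of the first representatives -/

/-- If `E` has infinitely many classes, then for every `p` there is a number `q` with exactly `p`
representatives below it, the approximation having stabilized below `q`. -/
theorem IsApprox.exists_stable {r : ℕ → ℕ → ℕ} {E : Setoid ℕ} (h : IsApprox r E)
    (hE : Infinite (Quotient E)) (p : ℕ) :
    ∃ q s₀, ∀ s, s₀ ≤ s → (∀ x < q, r s x = r s₀ x) ∧ repCount (r s) q = p := by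
  have hanti : ∀ x s s', s ≤ s' → r s' x ≤ r s x := by
    intro x s s' hs
    rw [← h.comp hs]
    exact h.le _ _
  have hlim : ∀ x, ∃ s, ∀ s', s ≤ s' → r s' x = r s x := by
    intro x
    obtain ⟨_, ⟨s, rfl⟩, hs⟩ := WellFounded.has_min (r := (· < ·)) wellFounded_lt
      (Set.range fun s => r s x) ⟨_, 0, rfl⟩
    exact ⟨s, fun s' hss => le_antisymm (hanti x s s' hss) (not_lt.1 (hs _ ⟨s', rfl⟩))⟩
  choose g hg using hlim
  -- the representatives in the limit form an infinite set, as every class contains one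
  have hinf : {x | r (g x) x = x}.Infinite := by
    intro hfin
    have := hfin.to_subtype
    refine not_finite_iff_infinite.2 hE (Finite.of_surjective
      (fun x : {x | r (g x) x = x} => Quotient.mk E x.1) ?_)
    intro c
    obtain ⟨x, rfl⟩ := Quotient.exists_rep c
    refine ⟨⟨r (g x) x, ?_⟩, Quotient.sound ?_⟩
    · change r (g (r (g x) x)) (r (g x) x) = r (g x) x
      rw [← hg (r (g x) x) (max (g x) (g (r (g x) x))) (le_max_right _ _),
        h.comp (le_max_left _ _), hg x _ (le_max_left _ _)]
    · exact (h.spec _ _).2 ⟨g x, h.idem _ _⟩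
  refine ⟨Nat.nth (fun x => r (g x) x = x) p,
    (Finset.range (Nat.nth (fun x => r (g x) x = x) p)).sup g, fun s hs => ?_⟩
  have hle : ∀ x < Nat.nth (fun x => r (g x) x = x) p,
      g x ≤ (Finset.range (Nat.nth (fun x => r (g x) x = x) p)).sup g :=
    fun x hx => Finset.le_sup (Finset.mem_range.2 hx)
  refine ⟨fun x hx => ?_, ?_⟩
  · rw [hg x s ((hle x hx).trans hs), hg x _ (hle x hx)]
  · rw [repCount_congr (ρ' := fun x => r (g x) x) fun x hx => hg x s ((hle x hx).trans hs),
      repCount_eq_count]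
    exact Nat.count_nth_of_infinite hinf p

/-! ### The strategy on the true path succeeds -/

/-- The last stage before `s` at which the strategy `k` acts. -/
def lastAction (v : ℕ → ℕ) (k : ℕ) : ℕ → ℕ
  | 0 => 0
  | s + 1 => if v s = k then s else lastAction v k s

theorem lastAction_le (v : ℕ → ℕ) (k s : ℕ) : lastAction v k s ≤ s := by
  induction s with
  | zero => exact le_rfl
  | succ s ih =>
    rw [lastAction]
    split_ifs <;> omega

theorem lastAction_succ {v : ℕ → ℕ} {k s : ℕ} (h : v s = k) : lastAction v k (s + 1) = s :=
  if_pos h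

theorem lastAction_mono {v : ℕ → ℕ} {k s s' : ℕ} (h : s ≤ s') :
    lastAction v k s ≤ lastAction v k s' := by
  induction s', h using Nat.le_induction with
  | base => exact le_rfl
  | succ n _ ih =>
    rw [lastAction]
    split_ifs
    · exact ih.trans (lastAction_le v k n)
    · exact ih

/-- The part of the stack at stage `s` that is visible to the strategy `k`. -/
def visibleStack (r : ℕ → ℕ → ℕ → ℕ) (v : ℕ → ℕ) (k s : ℕ) : List (ℕ × ℕ × ℕ) :=
  lowerPart k (stackAt r v s) ++ ownPart k (stackAt r v s)

theorem mem_of_mem_visibleStack {r : ℕ → ℕ → ℕ → ℕ} {v : ℕ → ℕ} {k s : ℕ} {e : ℕ × ℕ × ℕ}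
    (h : e ∈ visibleStack r v k s) : e ∈ stackAt r v s ∧ e.2.1 ≤ k := by
  simp only [visibleStack, lowerPart, ownPart, List.mem_append, List.mem_filter,
    decide_eq_true_eq] at h
  rcases h with h | h
  · exact ⟨h.1, h.2.le⟩
  · exact ⟨h.1, h.2.le⟩

theorem visibleStack_succ {r : ℕ → ℕ → ℕ → ℕ} {v : ℕ → ℕ} {k s : ℕ} (h : v s = k) :
    visibleStack r v k (s + 1) = stackAt r v (s + 1) := by
  subst h
  exact lowerPart_append_ownPart_nextStack

/-- At stage `s` the number `c` is the current image of `x` under the strategy `k`. -/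
def IsMatched (r : ℕ → ℕ → ℕ → ℕ) (v : ℕ → ℕ) (k s x c : ℕ) : Prop :=
  ((visibleStack r v k s)[repCount (r k (lastAction v k s)) (r k (lastAction v k s) x)]?).map
    Prod.fst = some c

/-- The own entries of the strategy `k` at stage `s` list the representatives below a bound that is
at least `N`, without the first `p`. -/
def IsListed (r : ℕ → ℕ → ℕ → ℕ) (v : ℕ → ℕ) (k p N s : ℕ) : Prop :=
  ∃ B, N ≤ B ∧ (ownPart k (stackAt r v s)).map (·.2.2) =
    (repList (r k (lastAction v k s)) B).drop p

section TruePath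
variable {r : ℕ → ℕ → ℕ → ℕ} {v : ℕ → ℕ} {k s₀ : ℕ} {X : Setoid ℕ}

theorem lowerPart_stackAt (hv : ∀ s, s₀ ≤ s → k ≤ v s) {s : ℕ} (hs : s₀ ≤ s) :
    lowerPart k (stackAt r v s) = lowerPart k (stackAt r v s₀) := by
  induction s, hs using Nat.le_induction with
  | base => rfl
  | succ n hn ih => rw [stackAt, lowerPart_nextStack (hv n hn), ih]

theorem stackAt_succ_labels (hr : IsApprox (r k) X) (hv : ∀ s, s₀ ≤ s → k ≤ v s) {p N s : ℕ}
    (hs : s₀ ≤ s) (hp : (lowerPart k (stackAt r v s₀)).length = p) (hk : v s = k)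
    (h : IsListed r v k p N s) :
    ∃ B, N + 1 ≤ B ∧ p < repCount (r k s) B ∧
      (ownPart k (stackAt r v (s + 1))).map (·.2.2) = (repList (r k s) B).drop p := by
  obtain ⟨B, hNB, hB⟩ := h
  obtain ⟨B', h1, h2, h3⟩ := ownPart_nextStack_labels (s := s) (hr.fix s)
    (fun x hx => hr.rep_of_le (lastAction_le v k s) hx)
    (by rw [lowerPart_stackAt hv hs, hp]) hB
  refine ⟨B', by omega, h2, ?_⟩
  rw [stackAt, hk]
  exact h3

theorem isListed_succ (hr : IsApprox (r k) X) (hv : ∀ s, s₀ ≤ s → k ≤ v s) {p N s : ℕ}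
    (hs : s₀ ≤ s) (hp : (lowerPart k (stackAt r v s₀)).length = p) (h : IsListed r v k p N s) :
    IsListed r v k p (if v s = k then N + 1 else N) (s + 1) := by
  split_ifs with hk
  · obtain ⟨B, h1, -, h3⟩ := stackAt_succ_labels hr hv hs hp hk h
    exact ⟨B, h1, by rw [lastAction_succ hk, h3]⟩
  · obtain ⟨B, h1, h2⟩ := h
    refine ⟨B, h1, ?_⟩
    rw [lastAction, if_neg hk, stackAt, ownPart_nextStack_of_lt, h2]
    exact lt_of_le_of_ne (hv s hs) (Ne.symm hk)

theorem exists_isListed (hr : IsApprox (r k) X) (hv : ∀ s, s₀ ≤ s → k ≤ v s)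
    (hinf : ∀ n, ∃ s, n ≤ s ∧ v s = k) (hown : ownPart k (stackAt r v s₀) = []) {p : ℕ}
    (hp : (lowerPart k (stackAt r v s₀)).length = p) (N : ℕ) :
    ∃ s₁, s₀ ≤ s₁ ∧ ∀ s, s₁ ≤ s → IsListed r v k p N s := by
  have hstep : ∀ {N s s'}, s₀ ≤ s → s ≤ s' → IsListed r v k p N s → IsListed r v k p N s' := by
    intro N s s' hs hss h
    induction s', hss using Nat.le_induction with
    | base => exact h
    | succ n hn ih =>
      obtain ⟨B, h1, h2⟩ := isListed_succ hr hv (hs.trans hn) hp ih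
      refine ⟨B, le_trans ?_ h1, h2⟩
      split_ifs <;> omega
  induction N with
  | zero => exact ⟨s₀, le_rfl, fun s hs => hstep le_rfl hs ⟨0, le_rfl, by simp [hown, repList]⟩⟩
  | succ N ih =>
    obtain ⟨s₁, hs₁, h⟩ := ih
    obtain ⟨s, hs, hk⟩ := hinf s₁
    refine ⟨s + 1, by omega, fun s' hs' => hstep (by omega) hs' ?_⟩
    have := isListed_succ hr hv (hs₁.trans hs) hp (h s hs)
    rwa [if_pos hk] at this

theorem visibleStack_label {p s i : ℕ} {e : ℕ × ℕ × ℕ}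
    (hp : (lowerPart k (stackAt r v s)).length = p) {a B : ℕ}
    (h : (ownPart k (stackAt r v s)).map (·.2.2) = (repList (r k a) B).drop p)
    (he : (visibleStack r v k s)[i]? = some e) (hi : p ≤ i) :
    e.2.1 = k ∧ r k a e.2.2 = e.2.2 ∧ e.2.2 < B ∧ repCount (r k a) e.2.2 = i := by
  rw [visibleStack, List.getElem?_append_right (by omega), hp] at he
  have hmem := List.mem_of_getElem? he
  simp only [ownPart, List.mem_filter, decide_eq_true_eq] at hmem
  refine ⟨hmem.2, ?_⟩
  have h1 : ((ownPart k (stackAt r v s)).map (·.2.2))[i - p]? = some e.2.2 := by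
    rw [List.getElem?_map, he]
    rfl
  rw [h, List.getElem?_drop, Nat.add_sub_cancel' hi] at h1
  exact getElem?_repList_eq_some.1 h1

theorem length_visibleStack {p s : ℕ} (hp : (lowerPart k (stackAt r v s)).length = p) {a B : ℕ}
    (h : (ownPart k (stackAt r v s)).map (·.2.2) = (repList (r k a) B).drop p)
    (hB : p ≤ repCount (r k a) B) : (visibleStack r v k s).length = repCount (r k a) B := by
  have := congrArg List.length h
  rw [List.length_map, List.length_drop] at this
  rw [visibleStack, List.length_append, hp, this]
  change p + (repCount (r k a) B - p) = _
  omega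

/-- The image of `x` under the strategy `k` stays the same up to the constructed equivalence
relation, once the first `p` representatives have stabilized. -/
theorem IsMatched.succ (hr : IsApprox (r k) X) (hv : ∀ s, s₀ ≤ s → k ≤ v s) {p q s₁ s : ℕ}
    (hs : s₀ ≤ s) (hp : (lowerPart k (stackAt r v s₀)).length = p)
    (hq : ∀ s, s₁ ≤ s → (∀ x < q, r k s x = r k s₁ x) ∧ repCount (r k s) q = p)
    (hs₁ : s₁ ≤ lastAction v k s) (hl : IsListed r v k p 0 s) {x c : ℕ}
    (h : IsMatched r v k s x c) :
    IsMatched r v k (s + 1) x (moveClass (r (v s) s) (v s) s (stackAt r v s) c) := by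
  obtain ⟨e, he, rfl⟩ := Option.map_eq_some_iff.1 h
  have hps : (lowerPart k (stackAt r v s)).length = p := by rw [lowerPart_stackAt hv hs, hp]
  have hes := (mem_of_mem_visibleStack (List.mem_of_getElem? he)).1
  have hek := (mem_of_mem_visibleStack (List.mem_of_getElem? he)).2
  by_cases hk : v s = k
  · have hps' : (lowerPart k (stackAt r v (s + 1))).length = p := by
      rw [lowerPart_stackAt hv (Nat.le_succ_of_le hs), hp]
    have hls : lastAction v k s ≤ s := lastAction_le v k s
    obtain ⟨B, -, hB⟩ := hl
    obtain ⟨B', hB', hpB', hlab'⟩ := stackAt_succ_labels hr hv hs hp hk ⟨B, le_rfl, hB⟩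
    have hlen := length_visibleStack hps' hlab' hpB'.le
    rw [IsMatched, lastAction_succ hk]
    by_cases hi : repCount (r k (lastAction v k s)) (r k (lastAction v k s) x) < p
    · -- `x` is matched with an entry of a stronger strategy
      have hyq : r k (lastAction v k s) x < q := by
        by_contra hlt
        have := repCount_mono (r k (lastAction v k s)) (not_lt.1 hlt)
        rw [(hq _ hs₁).2] at this
        omega
      have hrx : r k s x = r k (lastAction v k s) x := by
        rw [← hr.comp hls, (hq s (hs₁.trans hls)).1 _ hyq, ← (hq _ hs₁).1 _ hyq, hr.idem]
      have hcount : repCount (r k s) (r k (lastAction v k s) x) =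
          repCount (r k (lastAction v k s)) (r k (lastAction v k s) x) :=
        repCount_congr fun z hz => by
          rw [(hq s (hs₁.trans hls)).1 z (by omega), (hq _ hs₁).1 z (by omega)]
      have he' : (visibleStack r v k (s + 1))[repCount (r k s) (r k s x)]? = some e := by
        rw [visibleStack, List.getElem?_append_left (by omega)] at he
        rw [hrx, hcount, visibleStack, List.getElem?_append_left (by omega), ← he, lowerPart_stackAt hv hs, lowerPart_stackAt hv (Nat.le_succ_of_le hs)]
      rw [he', moveClass_of_mem]
      · rfl
      · exact List.mem_map_of_mem (mem_of_mem_visibleStack (List.mem_of_getElem? he')).1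
    · -- `x` is matched with an own entry, which carries the representative of `x` as its label
      obtain ⟨hek', hrep, heB, hcount⟩ := visibleStack_label hps hB he (not_lt.1 hi)
      have hlabel : e.2.2 = r k (lastAction v k s) x :=
        repCount_injOn hrep (hr.idem _ _) hcount
      have hrx : r k s x = r k s e.2.2 := by rw [hlabel, hr.comp hls]
      rw [hrx]
      by_cases hmem : e.1 ∈ (nextStack (r (v s) s) (v s) s (stackAt r v s)).map Prod.fst
      · rw [moveClass_of_mem hmem]
        obtain ⟨e', he', hee⟩ := List.mem_map.1 hmem
        have hlt := fst_lt_of_mem_stackAt e hes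
        have he'' : e' ∈ keptPart (r (v s) s) (v s) (stackAt r v s) := by
          rcases mem_nextStack he' with h' | h'
          · exact h'
          · omega
        obtain rfl := eq_of_mem_stackAt (mem_keptPart.1 he'').1 hes hee
        have hkept := (mem_keptPart.1 he'').2.resolve_left (by omega)
        rw [hk] at hkept
        have he3 : e' ∈ visibleStack r v k (s + 1) := by
          rw [visibleStack_succ hk]
          exact he'
        obtain ⟨j, hj⟩ := List.getElem?_of_mem he3
        have hpj : p ≤ j := by
          by_contra hlt
          rw [visibleStack, List.getElem?_append_left (by omega)] at hj
          have := List.mem_of_getElem? hj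
          simp only [lowerPart, List.mem_filter, decide_eq_true_eq] at this
          omega
        have := (visibleStack_label hps' hlab' hj hpj).2.2.2
        rw [hkept.2.1, this, hj]
        rfl
      · have hlt := fst_lt_of_mem_stackAt e hes
        have hhead : ((stackAt r v s).filter (fun e' => e'.1 = e.1 ∧ e'.2.1 = v s)).head? =
            some e := by
          have hef : e ∈ (stackAt r v s).filter (fun e' => e'.1 = e.1 ∧ e'.2.1 = v s) := by
            rw [List.mem_filter]
            exact ⟨hes, by simp [hek', hk]⟩
          cases hf : (stackAt r v s).filter (fun e' => e'.1 = e.1 ∧ e'.2.1 = v s) with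
          | nil => rw [hf] at hef; simp at hef
          | cons e' l =>
            have he' : e' ∈ (stackAt r v s).filter (fun e' => e'.1 = e.1 ∧ e'.2.1 = v s) := by
              rw [hf]
              exact List.mem_cons_self
            rw [List.mem_filter] at he'
            have h1 : e'.1 = e.1 := (decide_eq_true_iff.1 he'.2).1
            rw [List.head?_cons, eq_of_mem_stackAt he'.1 hes h1]
        rw [moveClass, if_neg (by rintro (h' | h'); exacts [hmem h', by omega]), hhead,
          Option.bind_some]
        have hin : repCount (r k s) (r k s e.2.2) < (visibleStack r v k (s + 1)).length := by
          rw [hlen]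
          have := hr.le s e.2.2
          exact repCount_lt (hr.idem _ _) (by omega)
        rw [visibleStack_succ hk] at hin ⊢
        rw [stackAt] at hin ⊢
        rw [hk] at hin ⊢
        rw [List.getElem?_eq_getElem hin]
        rfl
  · have hlt : k < v s := lt_of_le_of_ne (hv s hs) (Ne.symm hk)
    have hvis : visibleStack r v k (s + 1) = visibleStack r v k s := by
      rw [visibleStack, stackAt, ownPart_nextStack_of_lt hlt, lowerPart_nextStack hlt.le]
      rfl
    rw [IsMatched, lastAction, if_neg hk, hvis, he, moveClass_of_mem]
    · rfl
    · rw [← stackAt.eq_2]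
      rw [← hvis] at he
      exact List.mem_map_of_mem (mem_of_mem_visibleStack (List.mem_of_getElem? he)).1

end TruePath

section TruePath
variable {r : ℕ → ℕ → ℕ → ℕ} {v : ℕ → ℕ} {k : ℕ} {X : Setoid ℕ}

/-- A stronger strategy that acts clears the stack of the entries of `k`, so that at the least stage
after which no stronger strategy acts, `k` has no entries. -/
theorem exists_ownPart_eq_nil (h : ∃ s₀, ∀ s, s₀ ≤ s → k ≤ v s) :
    ∃ s₀, (∀ s, s₀ ≤ s → k ≤ v s) ∧ ownPart k (stackAt r v s₀) = [] := by
  classical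
  refine ⟨Nat.find h, Nat.find_spec h, ?_⟩
  cases hn : Nat.find h with
  | zero => rfl
  | succ n =>
    have h1 := Nat.find_min h (m := n) (by omega)
    push Not at h1
    obtain ⟨s, hs, hsk⟩ := h1
    have h2 := Nat.find_spec h
    have hvn : v n < k := by
      by_contra hlt
      rcases hs.eq_or_lt with rfl | hs
      · exact hlt hsk
      · have := h2 s (by omega)
        omega
    rw [List.eq_nil_iff_forall_not_mem]
    intro e he
    have he' := mem_ownPart.1 he
    rcases mem_nextStack he'.1 with h3 | h3
    · rcases (mem_keptPart.1 h3).2 with h4 | h4 <;> omega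
    · omega

/-- If `k` is the strategy on the true path, that is, the least one that acts infinitely often, then
the constructed equivalence relation is computably equivalent to the target of `k`. -/
theorem compEquiv_dynSetoid (hrp : Primrec fun a : ℕ × ℕ × ℕ => r a.1 a.2.1 a.2.2)
    (hvp : Primrec v) (hr : IsApprox (r k) X) (hX : Infinite (Quotient X))
    (hinf : ∀ n, ∃ s, n ≤ s ∧ v s = k) (hfin : ∃ s₀, ∀ s, s₀ ≤ s → k ≤ v s) :
    CompEquiv (dynSetoid r v) X := by
  obtain ⟨s₀, hv, hown⟩ := exists_ownPart_eq_nil (r := r) hfin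
  obtain ⟨p, hp⟩ : ∃ p, (lowerPart k (stackAt r v s₀)).length = p := ⟨_, rfl⟩
  obtain ⟨q, s₁, hq⟩ := hr.exists_stable hX p
  have hps : ∀ s, s₀ ≤ s → (lowerPart k (stackAt r v s)).length = p := fun s hs => by
    rw [lowerPart_stackAt hv hs, hp]
  have hlist := exists_isListed hr hv hinf hown hp
  obtain ⟨s₂, hs₀₂, hl₀⟩ := hlist 0
  -- `M x t s`: the action of `k` at stage `s` matches `x` with the class of `t`
  let M : ℕ → ℕ → ℕ → Prop := fun x t s => max s₁ s₂ ≤ s ∧ v s = k ∧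
    ((stackAt r v (s + 1))[repCount (r k s) (r k s x)]?).map Prod.fst = some (dynRep r v (s + 1) t)
  have hMprim : PrimrecPred fun a : ℕ × ℕ × ℕ => M a.1 a.2.1 a.2.2 := by
    have hv' : Primrec₂ fun (_ : ℕ) (s : ℕ) => v s := hvp.comp Primrec.snd
    have hs : Primrec fun a : ℕ × ℕ × ℕ => a.2.2 := Primrec.snd.comp Primrec.snd
    have ht : Primrec fun a : ℕ × ℕ × ℕ => a.2.1 := Primrec.fst.comp Primrec.snd
    have hrk : Primrec₂ fun (a : ℕ × ℕ × ℕ) (x : ℕ) => r k a.2.2 x :=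
      hrp.comp ((Primrec.const k).pair ((hs.comp Primrec.fst).pair Primrec.snd))
    have hstack : Primrec fun a : ℕ × ℕ × ℕ => stackAt r v (a.2.2 + 1) :=
      (primrec_stackAt hrp hv').comp (Primrec.const 0) (Primrec.succ.comp hs)
    have hrep : Primrec fun a : ℕ × ℕ × ℕ => dynRep r v (a.2.2 + 1) a.2.1 :=
      (primrec_dynRep hrp hv').comp ((Primrec.const 0).pair ((Primrec.succ.comp hs).pair ht))
    refine (Primrec.nat_le.comp (Primrec.const _) hs).and
      ((Primrec.eq.comp (hvp.comp hs) (Primrec.const k)).and (Primrec.eq.comp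
        (Primrec.option_map (Primrec.list_getElem?.comp hstack (primrec_repCount hrk
          (hrk.comp Primrec.id Primrec.fst))) (Primrec.fst.comp Primrec.snd).to₂)
        (Primrec.option_some.comp hrep)))
  have hmatch : ∀ {x c s}, v s = k → (IsMatched r v k (s + 1) x c ↔
      ((stackAt r v (s + 1))[repCount (r k s) (r k s x)]?).map Prod.fst = some c) := by
    intro x c s hk
    rw [IsMatched, visibleStack_succ hk, lastAction_succ hk]
  have hpersist : ∀ {x t s}, M x t s → ∀ n, s + 1 ≤ n → IsMatched r v k n x (dynRep r v n t) := by
    intro x t s hM n hn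
    have h12 := hM.1
    induction n, hn using Nat.le_induction with
    | base => exact (hmatch hM.2.1).2 hM.2.2
    | succ n hn ih =>
      refine IsMatched.succ hr hv (by omega) hp hq ?_ (hl₀ n (by omega)) ih
      have := lastAction_mono (v := v) (k := k) hn
      rw [lastAction_succ hM.2.1] at this
      omega
  -- at a common stage, matched numbers agree exactly when their preimages have been identified
  have hcompat : ∀ {x c x' c' s}, v s = k → IsMatched r v k (s + 1) x c →
      IsMatched r v k (s + 1) x' c' → (r k s x = r k s x' ↔ c = c') := by
    intro x c x' c' s hk h h'
    rw [hmatch hk] at h h'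
    rw [← List.getElem?_map] at h h'
    constructor
    · intro hxx
      rw [hxx, h'] at h
      exact (Option.some.inj h).symm
    · rintro rfl
      obtain ⟨hi, hi'⟩ := List.getElem?_eq_some_iff.1 h
      obtain ⟨hj, hj'⟩ := List.getElem?_eq_some_iff.1 h'
      have := ((nodup_stackAt (r := r) (v := v) (s + 1)).getElem_inj_iff
        (hi := hi) (hj := hj)).1 (hi'.trans hj'.symm)
      exact repCount_injOn (hr.idem _ _) (hr.idem _ _) this
  have hiff : ∀ {x t s x' t' s'}, M x t s → M x' t' s' → (X x x' ↔ dynSetoid r v t t') := by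
    intro x t s x' t' s' h h'
    constructor
    · intro hX
      obtain ⟨u, hu⟩ := (hr.spec x x').1 hX
      obtain ⟨n, hn, hk⟩ := hinf (s + s' + u)
      refine ⟨n + 1, (hcompat hk (hpersist h _ (by omega)) (hpersist h' _ (by omega))).1 ?_⟩
      exact hr.eq_of_le (by omega) hu
    · rintro ⟨u, hu⟩
      obtain ⟨n, hn, hk⟩ := hinf (s + s' + u)
      refine (hr.spec x x').2 ⟨n, (hcompat hk (hpersist h _ (by omega))
        (hpersist h' _ (by omega))).2 ?_⟩
      exact dynRep_eq_of_le (by omega) hu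
  have htot : ∀ x, ∃ t s, M x t s := by
    intro x
    obtain ⟨s₃, hs₃, hl⟩ := hlist x
    obtain ⟨s, hs, hk⟩ := hinf (s₁ + s₂ + s₃)
    obtain ⟨B, hxB, hpB, hlab⟩ := stackAt_succ_labels hr hv (by omega) hp hk (hl s (by omega))
    have hlen := length_visibleStack (hps (s + 1) (by omega)) hlab hpB.le
    rw [visibleStack_succ hk] at hlen
    have hlt : repCount (r k s) (r k s x) < (stackAt r v (s + 1)).length := by
      rw [hlen]
      have := hr.le s x
      exact repCount_lt (hr.idem _ _) (by omega)
    refine ⟨((stackAt r v (s + 1))[repCount (r k s) (r k s x)]).1, s, by omega, hk, ?_⟩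
    rw [List.getElem?_eq_getElem hlt, dynRep_of_mem (List.mem_map_of_mem (List.getElem_mem hlt))]
    rfl
  have hsurj : ∀ t, ∃ x s, M x t s := by
    intro t
    obtain ⟨s, hs, hk⟩ := hinf (s₁ + s₂ + t)
    obtain ⟨B, -, hpB, hlab⟩ := stackAt_succ_labels hr hv (by omega) hp hk (hl₀ s (by omega))
    obtain ⟨e, he, het⟩ := List.mem_map.1
      (dynRep_mem (r := r) (v := v) (show t < s + 1 by omega))
    obtain ⟨i, hi⟩ := List.getElem?_of_mem he
    suffices ∃ x, repCount (r k s) (r k s x) = i by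
      obtain ⟨x, hx⟩ := this
      refine ⟨x, s, by omega, hk, ?_⟩
      rw [hx, hi, ← het]
      rfl
    by_cases hip : i < p
    · have hlt : i < (repList (r k s) q).length := by
        change i < repCount (r k s) q
        rw [(hq s (by omega)).2]
        exact hip
      obtain ⟨h1, -, h3⟩ := getElem?_repList_eq_some.1 (List.getElem?_eq_getElem hlt)
      exact ⟨_, by rw [h1, h3]⟩
    · rw [← visibleStack_succ hk] at hi
      obtain ⟨-, h1, -, h3⟩ := visibleStack_label (hps (s + 1) (by omega)) hlab hi (not_lt.1 hip)
      exact ⟨_, by rw [h1, h3]⟩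
  refine ⟨compReducible_of_matching (M := fun t x s => M x t s) ?_ hsurj
    fun h h' => (hiff h h').symm, compReducible_of_matching hMprim htot hiff⟩
  exact hMprim.comp ((Primrec.fst.comp Primrec.snd).pair
    (Primrec.fst.pair (Primrec.snd.comp Primrec.snd)))

end TruePath

/-! ### Putting the infinite outcomes into competition -/

/-- The strategies that act at the stages of the construction with parameters `n` and `m`, for a
family `P` of sets: the stage `⟨j, t⟩` belongs to the strategy `j`, which watches the set
`P n (j / 2)` if `j` is even and `P m (j / 2)` if `j` is odd, and acts when `t` is in that set. If it
does not act, then a strategy that is weak enough to be harmless does. -/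
def actor (P : ℕ → ℕ → ℕ → Prop) [∀ n w t, Decidable (P n w t)] (a : ℕ × ℕ) (s : ℕ) : ℕ :=
  if P (if s.unpair.1 % 2 = 0 then a.1 else a.2) (s.unpair.1 / 2) s.unpair.2 then s.unpair.1 else s

section Actor
variable {P : ℕ → ℕ → ℕ → Prop} [∀ n w t, Decidable (P n w t)]

theorem primrec_actor (hP : PrimrecPred fun a : ℕ × ℕ × ℕ => P a.1 a.2.1 a.2.2) :
    Primrec₂ (actor P) := by
  have hu := Primrec.unpair.comp (Primrec.snd (α := ℕ × ℕ) (β := ℕ))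
  have hj := Primrec.fst.comp hu
  refine Primrec.ite (hP.comp (Primrec.pair (Primrec.ite (Primrec.eq.comp
    (Primrec.nat_mod.comp hj (Primrec.const 2)) (Primrec.const 0))
    (Primrec.fst.comp Primrec.fst) (Primrec.snd.comp Primrec.fst))
    (Primrec.pair (Primrec.nat_div.comp hj (Primrec.const 2)) (Primrec.snd.comp hu)))) hj
    Primrec.snd

theorem actor_frequently_iff (a : ℕ × ℕ) (j : ℕ) :
    (∀ n, ∃ s, n ≤ s ∧ actor P a s = j) ↔
      {t | P (if j % 2 = 0 then a.1 else a.2) (j / 2) t}.Infinite := by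
  constructor
  · intro h hfin
    obtain ⟨N, hN⟩ := hfin.bddAbove
    obtain ⟨s, hs, hsj⟩ := h (Nat.pair j (N + 1) + j + 1)
    rw [actor] at hsj
    by_cases h1 : P (if s.unpair.1 % 2 = 0 then a.1 else a.2) (s.unpair.1 / 2) s.unpair.2
    · -- the stages `⟨j, t⟩` with `t ≤ N` all lie below `⟨j, N + 1⟩`
      rw [if_pos h1] at hsj
      subst hsj
      have h2 : s.unpair.2 ≤ N := hN h1
      have h3 := Nat.pair_lt_pair_right s.unpair.1 (Nat.lt_succ_of_le h2)
      rw [Nat.pair_unpair] at h3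
      change s < Nat.pair _ (N + 1) at h3
      omega
    · rw [if_neg h1] at hsj
      omega
  · intro h n
    obtain ⟨t, ht, hnt⟩ := h.exists_gt n
    have ht' : P (if j % 2 = 0 then a.1 else a.2) (j / 2) t := ht
    refine ⟨Nat.pair j t, hnt.le.trans (Nat.right_le_pair j t), ?_⟩
    rw [actor, Nat.unpair_pair, if_pos ht']

/-- If some strategy acts infinitely often, then there is a least such strategy, and from some stage
on no stronger strategy acts. -/
theorem exists_least_frequent {v : ℕ → ℕ} (h : ∃ j, ∀ n, ∃ s, n ≤ s ∧ v s = j) :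
    ∃ k, (∀ n, ∃ s, n ≤ s ∧ v s = k) ∧ ∃ s₀, ∀ s, s₀ ≤ s → k ≤ v s := by
  classical
  refine ⟨Nat.find h, Nat.find_spec h, ?_⟩
  have hex : ∀ j, ∃ n, j < Nat.find h → ∀ s, n ≤ s → v s ≠ j := by
    intro j
    by_cases hj : j < Nat.find h
    · have := Nat.find_min h hj
      push Not at this
      obtain ⟨n, hn⟩ := this
      exact ⟨n, fun _ => hn⟩
    · exact ⟨0, fun hj' => absurd hj' hj⟩
  choose g hg using hex
  refine ⟨(Finset.range (Nat.find h)).sup g, fun s hs => ?_⟩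
  by_contra hlt
  rw [not_le] at hlt
  exact hg (v s) hlt s ((Finset.le_sup (Finset.mem_range.2 hlt)).trans hs) rfl

end Actor

/-- The ceer given by a program that enumerates an equivalence relation is that relation. -/
theorem ceer_encode_eq {c : Nat.Partrec.Code} {R : Setoid ℕ}
    (h : ∀ x y, (Nat.Partrec.Code.eval c (Nat.pair x y)).Dom ↔ R x y) :
    ceer (encode c) = R := by
  have hrel : (fun x y => Nat.pair x y ∈ ceSet (encode c)) = fun x y => R x y := by
    funext x y
    simp only [ceSet, Set.mem_ofPred_eq, ofNat_encode, h]
  rw [ceer, hrel]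
  exact Setoid.eqvGen_of_setoid R

theorem rfind_some_dom (b : ℕ → Bool) :
    (Nat.rfind fun s => Part.some (b s)).Dom ↔ ∃ s, b s = true := by
  refine Nat.rfind_dom'.trans ?_
  constructor
  · rintro ⟨s, hs, -⟩
    exact ⟨s, (Part.mem_some_iff.1 hs).symm⟩
  · rintro ⟨s, hs⟩
    exact ⟨s, Part.mem_some_iff.2 hs.symm, fun _ => trivial⟩

/-- The recursion theorem, for the construction with a parameter depending on an index of the ceer
that is being constructed. -/
theorem exists_fixedPoint_index {r : ℕ → ℕ → ℕ → ℕ} {v : ℕ × ℕ → ℕ → ℕ} {g : ℕ → ℕ}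
    (hr : Primrec fun a : ℕ × ℕ × ℕ => r a.1 a.2.1 a.2.2) (hv : Primrec₂ v) (hg : Computable g) :
    ∃ f : ℕ → ℕ, Computable f ∧ Function.Injective f ∧
      ∀ n, ceer (f n) = dynSetoid r (v (n, g (f n))) := by
  have hidx : Computable fun x : Nat.Partrec.Code × ℕ =>
      g (encode (Nat.Partrec.Code.curry x.1 x.2)) :=
    hg.comp (Primrec.encode.comp Nat.Partrec.Code.primrec₂_curry).to_comp
  let b : (ℕ × ℕ) × ℕ × ℕ → ℕ → Bool := fun x s =>
    decide (dynRep r (v x.1) s x.2.1 = dynRep r (v x.1) s x.2.2)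
  have hb : Primrec₂ b := by
    have h1 : Primrec fun y : ((ℕ × ℕ) × ℕ × ℕ) × ℕ => y.1.1 := Primrec.fst.comp Primrec.fst
    have h2 : Primrec fun y : ((ℕ × ℕ) × ℕ × ℕ) × ℕ => y.1.2 := Primrec.snd.comp Primrec.fst
    exact (Primrec.eq.comp
      ((primrec_dynRep hr hv).comp (h1.pair (Primrec.snd.pair (Primrec.fst.comp h2))))
      ((primrec_dynRep hr hv).comp (h1.pair (Primrec.snd.pair (Primrec.snd.comp h2))))).decide
  let F : Nat.Partrec.Code → ℕ →. ℕ := fun c z => Nat.rfind fun s => Part.some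
    (b ((z.unpair.1, g (encode (Nat.Partrec.Code.curry c z.unpair.1))), z.unpair.2.unpair) s)
  have hF : Partrec₂ F := by
    have hz : Primrec fun x : Nat.Partrec.Code × ℕ => x.2.unpair := Primrec.unpair.comp Primrec.snd
    have hpar : Computable fun x : Nat.Partrec.Code × ℕ =>
        (((x.2.unpair.1, g (encode (Nat.Partrec.Code.curry x.1 x.2.unpair.1))),
          x.2.unpair.2.unpair) : (ℕ × ℕ) × ℕ × ℕ) :=
      ((Primrec.fst.comp hz).to_comp.pair (hidx.comp
        (Computable.fst.pair (Primrec.fst.comp hz).to_comp))).pair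
        (Primrec.unpair.comp (Primrec.snd.comp hz)).to_comp
    have hcomp : Computable₂ fun (x : Nat.Partrec.Code × ℕ) (s : ℕ) =>
        b ((x.2.unpair.1, g (encode (Nat.Partrec.Code.curry x.1 x.2.unpair.1))),
          x.2.unpair.2.unpair) s :=
      hb.to_comp.comp (hpar.comp Computable.fst) Computable.snd
    exact Partrec.rfind hcomp.partrec₂
  obtain ⟨c, hc⟩ := Nat.Partrec.Code.fixed_point₂ hF
  refine ⟨fun n => encode (Nat.Partrec.Code.curry c n), ?_, ?_, fun n => ceer_encode_eq ?_⟩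
  · exact (Primrec.encode.comp (Nat.Partrec.Code.primrec₂_curry.comp (Primrec.const c)
      Primrec.id)).to_comp
  · intro n n' h
    exact (Nat.Partrec.Code.curry_inj (encode_injective h)).2
  · intro x y
    rw [Nat.Partrec.Code.eval_curry, hc]
    simp only [F, Nat.unpair_pair]
    rw [rfind_some_dom]
    exact exists_congr fun s => decide_eq_true_iff

theorem mem_ceerClosure_of_compEquiv {S : Set ℕ} {i j : ℕ} (h : CompEquiv (ceer i) (ceer j))
    (hj : j ∈ ceerClosure S) : i ∈ ceerClosure S := by
  obtain ⟨l, hl, hjl⟩ := hj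
  exact ⟨l, hl, h.trans hjl⟩

theorem ceerClosure_ceerClosure (S : Set ℕ) : ceerClosure (ceerClosure S) = ceerClosure S := by
  ext i
  constructor
  · rintro ⟨j, hj, hij⟩
    exact mem_ceerClosure_of_compEquiv hij hj
  · intro h
    exact ⟨i, h, ⟨⟨id, Computable.id, fun _ _ => Iff.rfl⟩, ⟨id, Computable.id, fun _ _ => Iff.rfl⟩⟩⟩

/-- The competition between the witnesses for `n ∈ 0'''` and those for `f n ∈ [S]`, where `f n` is an
index of the ceer constructed for `n`. -/
theorem setOneReducible_of_setMReducible {S : Set ℕ} (hS : ProperOnInfiniteCeers S)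
    (h : SetMReducible (ceerClosure S) zeroTripleJump) :
    SetOneReducible zeroTripleJump (ceerClosure S) := by
  classical
  obtain ⟨i, j, hi, hj, hiS, hjS⟩ := hS
  obtain ⟨g, hg, hgS⟩ := h
  obtain ⟨P, hP, hPe⟩ := exists_primrec_zeroTripleJump
  have hdec : ∀ n w t, Decidable (P n w t) := fun _ _ _ => Classical.dec _
  -- strategies of even index build a copy of `E_i`, those of odd index a copy of `E_j`
  let e : ℕ → ℕ := fun k => if k % 2 = 0 then i else j
  let r : ℕ → ℕ → ℕ → ℕ := fun k => if k % 2 = 0 then ceerRep i else ceerRep j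
  have hre : ∀ k, IsApprox (r k) (ceer (e k)) := by
    intro k
    by_cases hk : k % 2 = 0
    · simp only [r, e, if_pos hk]
      exact isApprox_ceerRep i
    · simp only [r, e, if_neg hk]
      exact isApprox_ceerRep j
  have hr : Primrec fun a : ℕ × ℕ × ℕ => r a.1 a.2.1 a.2.2 := by
    refine (Primrec.ite (Primrec.eq.comp (Primrec.nat_mod.comp Primrec.fst (Primrec.const 2))
      (Primrec.const 0)) ((primrec_ceerRep i).comp (Primrec.fst.comp Primrec.snd)
        (Primrec.snd.comp Primrec.snd)) ((primrec_ceerRep j).comp (Primrec.fst.comp Primrec.snd)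
        (Primrec.snd.comp Primrec.snd))).of_eq fun a => ?_
    simp only [r]
    split_ifs <;> rfl
  obtain ⟨f, hf, hfinj, hfix⟩ := exists_fixedPoint_index hr (primrec_actor hP) hg
  have hwin : ∀ n, (∃ k, ∀ N, ∃ s, N ≤ s ∧ actor P (n, g (f n)) s = k) →
      ∃ k, (∀ N, ∃ s, N ≤ s ∧ actor P (n, g (f n)) s = k) ∧
        CompEquiv (ceer (f n)) (ceer (e k)) := by
    intro n hn
    obtain ⟨k, hk, hfin⟩ := exists_least_frequent hn
    refine ⟨k, hk, ?_⟩
    rw [hfix]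
    refine compEquiv_dynSetoid hr ((primrec_actor hP).comp (Primrec.const _) Primrec.id) (hre k) ?_
      hk hfin
    simp only [e]
    split_ifs
    · exact hi
    · exact hj
  have heven : ∀ n, n ∈ zeroTripleJump ↔
      ∃ k, k % 2 = 0 ∧ ∀ N, ∃ s, N ≤ s ∧ actor P (n, g (f n)) s = k := by
    intro n
    simp only [actor_frequently_iff, hPe]
    constructor
    · rintro ⟨w, hw⟩
      have h1 : 2 * w % 2 = 0 := by omega
      have h2 : 2 * w / 2 = w := by omega
      exact ⟨2 * w, h1, by rwa [if_pos h1, h2]⟩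
    · rintro ⟨k, hk, h⟩
      rw [if_pos hk] at h
      exact ⟨_, h⟩
  have hodd : ∀ n, f n ∈ ceerClosure S ↔
      ∃ k, k % 2 ≠ 0 ∧ ∀ N, ∃ s, N ≤ s ∧ actor P (n, g (f n)) s = k := by
    intro n
    rw [show f n ∈ ceerClosure S ↔ g (f n) ∈ zeroTripleJump from hgS (f n)]
    simp only [actor_frequently_iff, hPe]
    constructor
    · rintro ⟨w, hw⟩
      have h1 : ¬ (2 * w + 1) % 2 = 0 := by omega
      have h2 : (2 * w + 1) / 2 = w := by omega
      exact ⟨2 * w + 1, h1, by rwa [if_neg h1, h2]⟩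
    · rintro ⟨k, hk, h⟩
      rw [if_neg hk] at h
      exact ⟨_, h⟩
  refine ⟨f, hf, hfinj, fun n => ?_⟩
  change n ∈ zeroTripleJump ↔ f n ∈ ceerClosure S
  constructor
  · intro hn
    obtain ⟨k, -, hk⟩ := (heven n).1 hn
    obtain ⟨l, hl, hequiv⟩ := hwin n ⟨k, hk⟩
    by_cases hl2 : l % 2 = 0
    · simp only [e, if_pos hl2] at hequiv
      exact mem_ceerClosure_of_compEquiv hequiv hiS
    · exact (hodd n).2 ⟨l, hl2, hl⟩
  · intro hn
    obtain ⟨k, -, hk⟩ := (hodd n).1 hn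
    obtain ⟨l, hl, hequiv⟩ := hwin n ⟨k, hk⟩
    by_cases hl2 : l % 2 = 0
    · exact (heven n).2 ⟨l, hl2, hl⟩
    · simp only [e, if_neg hl2] at hequiv
      exact absurd (mem_ceerClosure_of_compEquiv hequiv.symm hn) hjS

theorem mainTheorem5 (S : Set ℕ) (hS : ProperOnInfiniteCeers (ceerClosure S)) :
    ¬ SetMLt (ceerClosure S) zeroTripleJump ∧
    ¬ SetOneLt (ceerClosure S) zeroTripleJump ∧
    (SetMReducible (ceerClosure S) zeroTripleJump →
      SetOneReducible zeroTripleJump (ceerClosure S)) := by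
  have hmain : SetMReducible (ceerClosure S) zeroTripleJump →
      SetOneReducible zeroTripleJump (ceerClosure S) := by
    have h := setOneReducible_of_setMReducible hS
    rwa [ceerClosure_ceerClosure] at h
  exact ⟨fun h => h.2 (hmain h.1).to_many_one, fun h => h.2 (hmain h.1.to_many_one), hmain⟩
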